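/- Let $D=\overline{B_2(0,1)}\times[0,1]\subset\mathbb R^3$ be the cylinder over the closed unit disc, let $T>0$, and write $L^q_tL^p_x=L^q(0,T;L^p(D))$. Consider the Navier–Stokes equations $$\Delta v-v\cdot\nabla v-\nabla P-\partial_t v=f,\qquad \nabla\cdot v=0\qquad\text{in }D\times[0,T),\tag{NS}$$ with the no slip condition $v=0$ on the vertical boundary $\{x\in D:x_1^2+x_2^2=1\}$ and the Navier total slip condition $v_3=0,\ \partial_{x_3}v_1=\partial_{x_3}v_2=0$ on the horizontal boundary $\{x\in D:x_3\in\{0,1\}\}$. Let $1\le q\le\infty$ and $1\le p<\infty$ satisfy $p<1+\frac1q$ (with $\frac1\infty=0$, so that necessarily $q<\infty$), and let $1\le\widetilde q\le\infty$ and $1\le\widetilde p<\infty$ be arbitrary (in particular, arbitrarily large). Then there are a force $f\in L^q_tL^p_x$ and a velocity $v$ and pressure $P$ such that: 1. $f$, $v$ and $P$ are smooth on $D\times[0,T)$ (up to the boundary of $D$ and up to $t=0$), and $(v,P)$ solves (NS) with the above boundary conditions; 2. $v$ is unique: if $(w,Q)$ is a classical solution of (NS) on $D\times[0,T)$ ($w$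 of class $C^2$ and $Q$ of class $C^1$ on $D\times[0,T)$) with the same force $f$, the same boundary conditions and $w(\cdot,0)=v(\cdot,0)$, then $w=v$ on $D\times[0,T)$; 3. $v\in L^\infty_tL^2_x\cap L^2_tH^1_x$ and $v\in L^{\widetilde q}_tL^{\widetilde p}_x$; 4. $\displaystyle\lim_{t\to T^-}\|v(\cdot,t)\|_{L^\infty(D)}=+\infty$, and blow-up occurs only at time $T$: $v$ is bounded on $D\times[0,S]$ for every $0\le S<T$. In particular this holds for $q=1$ and every $1\le p<2$ (forces in $L^1_tL^p_x$), and for $p=1$ and every $1\le q<\infty$ (forces in $L^q_tL^1_x$, the range of Zhang's theorem). -/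

import Mathlib

open MeasureTheory Set Filter Topology
open scoped ENNReal ContDiff Gradient Laplacian

namespace NSCylinder

/-- Three-dimensional Euclidean space; the coordinates `x 0, x 1, x 2` are `x₁, x₂, x₃`. -/
abbrev E3 : Type := EuclideanSpace ℝ (Fin 3)

/-- The closed cylinder `D`: the unit disc in the horizontal variables times `[0, 1]`. -/
def D : Set E3 := {x | x 0 ^ 2 + x 1 ^ 2 ≤ 1 ∧ 0 ≤ x 2 ∧ x 2 ≤ 1}

/-- The vertical (lateral) part of the boundary of `D`. -/
def verticalBoundary : Set E3 := {x | x ∈ D ∧ x 0 ^ 2 + x 1 ^ 2 = 1}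

/-- The horizontal part (bottom and top) of the boundary of `D`. -/
def horizontalBoundary : Set E3 := {x | x ∈ D ∧ (x 2 = 0 ∨ x 2 = 1)}

/-- The `i`-th vector of the standard basis. -/
noncomputable def stdVec (i : Fin 3) : E3 := EuclideanSpace.single i 1

/-- The divergence `∂₁ u₁ + ∂₂ u₂ + ∂₃ u₃` of a vector field. -/
noncomputable def divergence (u : E3 → E3) (x : E3) : ℝ :=
  ∑ i : Fin 3, fderiv ℝ u x (stdVec i) i

/-- No slip: the field vanishes on the vertical boundary. -/
def NoSlipVertical (u : E3 → E3) : Prop :=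
  ∀ x ∈ verticalBoundary, u x = 0

/-- Navier total slip on the horizontal boundary. As this part of the boundary is flat with normal
`± e₃`, the condition reads `u₃ = 0` and `∂₃ u₁ = ∂₃ u₂ = 0`; the derivative is the one from inside
`D`. -/
def TotalSlipHorizontal (u : E3 → E3) : Prop :=
  ∀ x ∈ horizontalBoundary,
    u x 2 = 0 ∧ fderivWithin ℝ u D x (stdVec 2) 0 = 0 ∧ fderivWithin ℝ u D x (stdVec 2) 1 = 0

/-- `g ∈ L^q(0, T; L^p(D))`: `g` is measurable on `(0, T) × D` and the `L^q(0, T)` norm of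
`t ↦ ‖g(t)‖_{L^p(D)}` is finite. -/
def MemLqLp {F : Type*} [NormedAddCommGroup F] (T : ℝ) (q p : ℝ≥0∞) (g : ℝ → E3 → F) : Prop :=
  AEStronglyMeasurable (Function.uncurry g)
      ((volume.restrict (Ioo 0 T)).prod (volume.restrict D)) ∧
    eLpNorm (fun t => eLpNorm (g t) p (volume.restrict D)) q (volume.restrict (Ioo 0 T)) < ⊤

/-- `(v, P)` is a classical solution on `D × [0, T)` of
`Δv - v·∇v - ∇P - ∂ₜv = f`, `div v = 0`, with no slip on the vertical boundary and total slip on the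
horizontal one: `v` is `C²` and `P` is `C¹` up to the boundary and up to time `0`, and the equations
hold in the interior (hence, by continuity, up to the boundary when `f` is continuous). -/
structure IsClassicalSolution (T : ℝ) (f v : ℝ → E3 → E3) (P : ℝ → E3 → ℝ) : Prop where
  velocity_regular : ContDiffOn ℝ 2 (Function.uncurry v) (Ico 0 T ×ˢ D)
  pressure_regular : ContDiffOn ℝ 1 (Function.uncurry P) (Ico 0 T ×ˢ D)
  momentum : ∀ t ∈ Ioo 0 T, ∀ x ∈ interior D,
    Δ (v t) x - fderiv ℝ (v t) x (v t x) - ∇ (P t) x - deriv (fun s => v s x) t = f t x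
  incompressible : ∀ t ∈ Ioo 0 T, ∀ x ∈ interior D, divergence (v t) x = 0
  no_slip : ∀ t ∈ Ico 0 T, NoSlipVertical (v t)
  total_slip : ∀ t ∈ Ico 0 T, TotalSlipHorizontal (v t)

/-- There are a force `f ∈ L^q_t L^p_x`, smooth on `D × [0, T)`, and a corresponding smooth solution
`v` (with smooth pressure `P`), the only classical one with its initial velocity, which lies in
`L^∞_t L^2_x ∩ L^2_t H^1_x` and in `L^q'_t L^p'_x`, and whose `L^∞` norm blows up at time `T` and not
before. -/
def ExistsBlowup (T : ℝ) (q p q' p' : ℝ≥0∞) : Prop :=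
  ∃ (f v : ℝ → E3 → E3) (P : ℝ → E3 → ℝ),
    -- the force
    MemLqLp T q p f ∧
    ContDiffOn ℝ ∞ (Function.uncurry f) (Ico 0 T ×ˢ D) ∧
    -- the solution and its smoothness
    IsClassicalSolution T f v P ∧
    ContDiffOn ℝ ∞ (Function.uncurry v) (Ico 0 T ×ˢ D) ∧
    ContDiffOn ℝ ∞ (Function.uncurry P) (Ico 0 T ×ˢ D) ∧
    -- uniqueness of the velocity
    (∀ (w : ℝ → E3 → E3) (Q : ℝ → E3 → ℝ), IsClassicalSolution T f w Q →
      (∀ x ∈ D, w 0 x = v 0 x) → ∀ t ∈ Ico 0 T, ∀ x ∈ D, w t x = v t x) ∧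
    -- `L^∞_t L^2_x ∩ L^2_t H^1_x`; the field is smooth, so its gradient is the classical one
    MemLqLp T ⊤ 2 v ∧
    MemLqLp T 2 2 v ∧ MemLqLp T 2 2 (fun t x => fderiv ℝ (v t) x) ∧
    -- the prescribed large exponents
    MemLqLp T q' p' v ∧
    -- blow-up at time `T`
    Tendsto (fun t => eLpNorm (v t) ⊤ (volume.restrict D)) (𝓝[<] T) (𝓝 ⊤) ∧
    -- and at no earlier time
    (∀ S ∈ Ico 0 T, ∃ C : ℝ, ∀ t ∈ Icc 0 S, ∀ x ∈ D, ‖v t x‖ ≤ C)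

end NSCylinder

namespace NSCylinder

/-! ### Geometry of the cylinder -/

/-! The flow is a pure swirl. With `ρ = x₁² + x₂²`, `τ = T - t` and `b = 1/2 + η`, put `v = (1 -
ρ)(τ + ρ)^(-b) (-x₂, x₁, 0)`. Such a field is divergence free, independent of `x₃` and without third
component. The factor `1 - ρ` enforces no slip. Its convective term is purely centripetal, hence
cancelled by the gradient of a radial pressure (`convection_swirl`). The nonlinearity disappears and
the force is just `Δv - ∂ₜv`.

Since `(-x₂, x₁, 0)` has length `√ρ`, up to constants `|v| ≤ (τ + ρ)^(-η)`, `|∇v| ≤ (τ + ρ)^(-b)`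
and `|f| ≤ (τ + ρ)^(-(1 + η))`. At `ρ = τ` the velocity has size `τ^(-η)`, so it blows up, but so
slowly that every finite `L^p` norm survives when `η` is small.

Membership in mixed spaces rests on the splitting `(τ + ρ)^(-(a + c)) ≤ τ^(-a) ∏ |xᵢ|^(-c)`, which
is in `L^q_t L^p_x` once `a q < 1` and `c p < 1` (`memLqLp_of_le`). For the force one needs `a + c =
1 + η`, which is possible for small `η` because `p < 1 + 1/q` implies `1/p + 1/q > 1`.

Uniqueness is the energy method: the boundary conditions remove all boundary fluxes of the
difference of two solutions (`integral_inner_le`), the gradient of `v` is bounded before `T`, and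
Grönwall's argument applies (`IsClassicalSolution.unique`). -/

theorem isClosed_D : IsClosed D := by
  have h0 : Continuous fun x : E3 => x 0 ^ 2 + x 1 ^ 2 := by fun_prop
  have h2 : Continuous fun x : E3 => x 2 := by fun_prop
  exact (isClosed_le h0 continuous_const).inter
    ((isClosed_le continuous_const h2).inter (isClosed_le h2 continuous_const))

theorem isCompact_D : IsCompact D := by
  refine Metric.isCompact_of_isClosed_isBounded isClosed_D ?_
  refine (Metric.isBounded_closedBall (x := (0 : E3)) (r := 2)).subset fun x hx => ?_
  obtain ⟨h, h0, h1⟩ := hx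
  rw [mem_closedBall_zero_iff, EuclideanSpace.norm_eq, Real.sqrt_le_left (by norm_num)]
  simp only [Fin.sum_univ_three, Real.norm_eq_abs, sq_abs]
  nlinarith

theorem convex_D : Convex ℝ D := by
  rintro x ⟨hx, hx0, hx1⟩ y ⟨hy, hy0, hy1⟩ a b ha hb hab
  refine ⟨?_, ?_, ?_⟩ <;> simp only [PiLp.add_apply, PiLp.smul_apply, smul_eq_mul]
  · obtain rfl : b = 1 - a := by linarith
    nlinarith [mul_nonneg ha hb, mul_nonneg (mul_nonneg ha hb)
      (add_nonneg (sq_nonneg (x 0 - y 0)) (sq_nonneg (x 1 - y 1)))]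
  · positivity
  · nlinarith

theorem isOpen_strict_D : IsOpen {x : E3 | x 0 ^ 2 + x 1 ^ 2 < 1 ∧ 0 < x 2 ∧ x 2 < 1} := by
  have h0 : Continuous fun x : E3 => x 0 ^ 2 + x 1 ^ 2 := by fun_prop
  have h2 : Continuous fun x : E3 => x 2 := by fun_prop
  exact (isOpen_lt h0 continuous_const).inter
    ((isOpen_lt continuous_const h2).inter (isOpen_lt h2 continuous_const))

theorem strict_D_subset_interior :
    {x : E3 | x 0 ^ 2 + x 1 ^ 2 < 1 ∧ 0 < x 2 ∧ x 2 < 1} ⊆ interior D :=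
  interior_maximal (fun _ hx => ⟨hx.1.le, hx.2.1.le, hx.2.2.le⟩) isOpen_strict_D

theorem nonempty_interior_D : (interior D).Nonempty :=
  ⟨!₂[0, 0, 1 / 2], strict_D_subset_interior (by simp; norm_num)⟩

theorem uniqueDiffOn_D : UniqueDiffOn ℝ D := uniqueDiffOn_convex convex_D nonempty_interior_D

theorem measurableSet_D : MeasurableSet D := isClosed_D.measurableSet

theorem D_subset_closure_interior : D ⊆ closure (interior D) :=
  convex_D.closure_interior_eq_closure_of_nonempty_interior nonempty_interior_D ▸ subset_closure

instance : IsFiniteMeasure ((volume : Measure E3).restrict D) :=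
  ⟨by simpa using isCompact_D.measure_lt_top⟩

/-- A property of the interior of `D` holds almost everywhere on `D`. -/
theorem ae_interior_D {p : E3 → Prop} (h : ∀ x ∈ interior D, p x) :
    ∀ᵐ x ∂(volume.restrict D), p x := by
  rw [ae_restrict_iff' measurableSet_D]
  have h0 : ∀ᵐ x : E3, x ∉ frontier D :=
    measure_eq_zero_iff_ae_notMem.1 (convex_D.addHaar_frontier volume)
  filter_upwards [h0] with x hx hxD
  exact h x (by by_contra hc; exact hx ⟨subset_closure hxD, hc⟩)

/-! ### The divergence theorem on the cylinder -/

theorem stdVec_apply (i j : Fin 3) : stdVec i j = if j = i then 1 else 0 := by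
  simp [stdVec]

/-- The integral of `∂ᵢ G` over the part in `D` of a line in the `i`-th direction vanishes if `G`
does at the two end points. -/
theorem integral_line_eq_zero {G : E3 → ℝ} (hG : ContDiffOn ℝ 1 G D) (e : E3) (he : e ≠ 0)
    (hend : ∀ x ∈ D, ((∀ t > (0 : ℝ), x + t • e ∉ D) ∨ (∀ t < (0 : ℝ), x + t • e ∉ D)) → G x = 0)
    (a : E3) :
    ∫ t : ℝ, D.indicator (fun x => fderivWithin ℝ G D x e) (a + t • e) = 0 := by
  set S : Set ℝ := (fun t : ℝ => a + t • e) ⁻¹' D with hS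
  have hcont : Continuous fun t : ℝ => a + t • e := by fun_prop
  have hind : (fun t : ℝ => D.indicator (fun x => fderivWithin ℝ G D x e) (a + t • e))
      = S.indicator (fun t => fderivWithin ℝ G D (a + t • e) e) := by
    ext t; rfl
  have hSc : IsClosed S := isClosed_D.preimage hcont
  rw [hind, integral_indicator hSc.measurableSet]
  rcases S.eq_empty_or_nonempty with h0 | hne
  · simp [h0]
  -- Convexity and compactness make the chord a closed interval, possibly a single point, on which
  -- the fundamental theorem of calculus applies.
  have hconv : Convex ℝ S := by
    have : S = (AffineMap.lineMap a (a + e) : ℝ →ᵃ[ℝ] E3) ⁻¹' D := by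
      ext t; simp [hS, AffineMap.lineMap_apply, add_comm]
    rw [this]; exact convex_D.affine_preimage _
  have hbdd : Bornology.IsBounded S := by
    obtain ⟨R, hR⟩ := isCompact_D.isBounded.exists_norm_le
    refine (Metric.isBounded_closedBall (x := (0 : ℝ)) (r := (R + ‖a‖) / ‖e‖)).subset
      fun t ht => ?_
    have he' : 0 < ‖e‖ := norm_pos_iff.2 he
    rw [mem_closedBall_zero_iff, le_div_iff₀ he', ← norm_smul]
    calc ‖t • e‖ = ‖(a + t • e) - a‖ := by simp
      _ ≤ ‖a + t • e‖ + ‖a‖ := norm_sub_le _ _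
      _ ≤ R + ‖a‖ := by gcongr; exact hR _ ht
  have hIcc := eq_Icc_of_connected_compact ⟨hne, hconv.isPreconnected⟩
    (Metric.isCompact_of_isClosed_isBounded hSc hbdd)
  set p := sInf S
  set q := sSup S
  have hpq : p ≤ q := by
    rw [hIcc] at hne; exact nonempty_Icc.1 hne
  have hpD : a + p • e ∈ D := by
    have : p ∈ S := by rw [hIcc]; exact left_mem_Icc.2 hpq
    exact this
  have hqD : a + q • e ∈ D := by
    have : q ∈ S := by rw [hIcc]; exact right_mem_Icc.2 hpq
    exact this
  have hGp : G (a + p • e) = 0 := hend _ hpD <| Or.inr fun t ht hD => by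
    have : p + t ∈ S := by simpa [hS, add_smul, add_assoc] using hD
    rw [hIcc] at this; linarith [this.1]
  have hGq : G (a + q • e) = 0 := hend _ hqD <| Or.inl fun t ht hD => by
    have : q + t ∈ S := by simpa [hS, add_smul, add_assoc] using hD
    rw [hIcc] at this; linarith [this.2]
  have hmaps : MapsTo (fun t : ℝ => a + t • e) (Icc p q) D := fun t ht => by
    rw [← hIcc] at ht; exact ht
  have hder : ∀ t ∈ Icc p q, HasDerivWithinAt (fun t : ℝ => G (a + t • e))
      (fderivWithin ℝ G D (a + t • e) e) (Icc p q) t := fun t ht => by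
    have h1 : HasDerivWithinAt (fun t : ℝ => a + t • e) e (Icc p q) t := by
      simpa using (((hasDerivAt_id t).smul_const e).const_add a).hasDerivWithinAt
    exact ((hG.differentiableOn one_ne_zero _ (hmaps ht)).hasFDerivWithinAt).comp_hasDerivWithinAt
      t h1 hmaps
  have hc' : ContinuousOn (fun t : ℝ => fderivWithin ℝ G D (a + t • e) e) (Icc p q) :=
    ((hG.continuousOn_fderivWithin uniqueDiffOn_D le_rfl).comp hcont.continuousOn hmaps).clm_apply
      continuousOn_const
  rw [hIcc, integral_Icc_eq_integral_Ioc, ← intervalIntegral.integral_of_le hpq,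
    intervalIntegral.integral_eq_sub_of_hasDerivAt_of_le hpq
      (f := fun t : ℝ => G (a + t • e)) (fun t ht => (hder t ht).continuousWithinAt)
      (fun t ht => (hder t (Ioo_subset_Icc_self ht)).hasDerivAt (Icc_mem_nhds ht.1 ht.2))
      (hc'.intervalIntegrable_of_Icc hpq), hGp, hGq, sub_zero]

/-- Fubini's theorem on `E3` along the `i`-th coordinate direction, for vanishing line integrals. -/
theorem integral_eq_zero_of_line (i : Fin 3) {h : E3 → ℝ} (hi : Integrable h)
    (hl : ∀ a : E3, ∫ t : ℝ, h (a + t • stdVec i) = 0) : ∫ x, h x = 0 := by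
  have h1 := PiLp.volume_preserving_toLp (Fin 3)
  have h2 := (volume_preserving_piFinSuccAbove (fun _ : Fin 3 => ℝ) i).symm
  have e1 := (MeasurableEquiv.toLp 2 (Fin 3 → ℝ)).measurableEmbedding
  have e2 := (MeasurableEquiv.piFinSuccAbove (fun _ : Fin 3 => ℝ) i).symm.measurableEmbedding
  have hi1 : Integrable (h ∘ WithLp.toLp 2) (volume : Measure (Fin 3 → ℝ)) :=
    (h1.integrable_comp_emb e1).2 hi
  have hi2 : Integrable (fun z : ℝ × (Fin 2 → ℝ) => h (WithLp.toLp 2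
      ((MeasurableEquiv.piFinSuccAbove (fun _ : Fin 3 => ℝ) i).symm z))) volume :=
    (h2.integrable_comp_emb e2).2 hi1
  rw [← h1.integral_comp e1, ← h2.integral_comp e2 (fun x => h (WithLp.toLp 2 x))]
  rw [show (volume : Measure (ℝ × (Fin 2 → ℝ))) = volume.prod volume from rfl] at hi2 ⊢
  rw [integral_prod_symm _ hi2]
  refine integral_eq_zero_of_ae (ae_of_all _ fun y => ?_)
  rw [Pi.zero_apply, ← hl (WithLp.toLp 2 (i.insertNth 0 y))]
  refine integral_congr_ae (ae_of_all _ fun t => ?_)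
  simp only [MeasurableEquiv.piFinSuccAbove_symm_apply]
  congr 1
  ext j
  refine Fin.succAboveCases i ?_ (fun k => ?_) j
  · simp [stdVec_apply, Fin.insertNthEquiv]
  · simp [stdVec_apply, Fin.insertNthEquiv, Fin.succAbove_ne]

theorem integrableOn_fderivWithin_D {G : E3 → ℝ} (hG : ContDiffOn ℝ 1 G D) (e : E3) :
    IntegrableOn (fun x => fderivWithin ℝ G D x e) D :=
  ((hG.continuousOn_fderivWithin uniqueDiffOn_D le_rfl).clm_apply
    continuousOn_const).integrableOn_compact isCompact_D

/-- Extending the derivative by zero outside `D` turns every chord into a full line, so that Fubini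
along one axis suffices and no surface measure is needed. -/
theorem setIntegral_fderivWithin_eq_zero {G : E3 → ℝ} (hG : ContDiffOn ℝ 1 G D) (i : Fin 3)
    (hend : ∀ x ∈ D, ((∀ t > (0 : ℝ), x + t • stdVec i ∉ D) ∨
      (∀ t < (0 : ℝ), x + t • stdVec i ∉ D)) → G x = 0) :
    ∫ x in D, fderivWithin ℝ G D x (stdVec i) = 0 := by
  rw [← integral_indicator measurableSet_D]
  refine integral_eq_zero_of_line i
    ((integrable_indicator_iff measurableSet_D).2 (integrableOn_fderivWithin_D hG _)) fun a => ?_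
  exact integral_line_eq_zero hG _ (by simp [stdVec]) hend a

/-- The horizontal lines leave `D` through the vertical boundary, the vertical lines through the
horizontal one. -/
theorem mem_boundary_of_exit {x : E3} (hx : x ∈ D) (i : Fin 3)
    (hexit : (∀ t > (0 : ℝ), x + t • stdVec i ∉ D) ∨ (∀ t < (0 : ℝ), x + t • stdVec i ∉ D)) :
    x ∈ verticalBoundary ∨ (i = 2 ∧ x ∈ horizontalBoundary) := by
  by_contra! hcon
  obtain ⟨hv, hh⟩ := hcon
  obtain ⟨h, h0, h1⟩ := id hx
  have hlt : x 0 ^ 2 + x 1 ^ 2 < 1 := lt_of_le_of_ne h fun h' => hv ⟨hx, h'⟩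
  have hev : ∀ᶠ t : ℝ in 𝓝 0, x + t • stdVec i ∈ D := by
    have c0 : Continuous fun t : ℝ => (x + t • stdVec i) 0 ^ 2 + (x + t • stdVec i) 1 ^ 2 := by
      fun_prop
    have c2 : Continuous fun t : ℝ => (x + t • stdVec i) 2 := by fun_prop
    have e0 : ∀ᶠ t : ℝ in 𝓝 0, (x + t • stdVec i) 0 ^ 2 + (x + t • stdVec i) 1 ^ 2 < 1 :=
      c0.continuousAt.eventually_lt continuousAt_const (by simpa using hlt)
    -- A horizontal displacement does not change `x₃`, so the non-strict constraints on `x₃` persist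
    -- even on the top and bottom; only vertical displacements need them to be strict.
    by_cases hi : i = 2
    · have hne := hh hi
      have h0' : 0 < x 2 := lt_of_le_of_ne h0 fun h' => hne ⟨hx, Or.inl h'.symm⟩
      have h1' : x 2 < 1 := lt_of_le_of_ne h1 fun h' => hne ⟨hx, Or.inr h'⟩
      filter_upwards [e0, continuousAt_const.eventually_lt (g := fun t : ℝ =>
        (x + t • stdVec i) 2) c2.continuousAt (by simpa using h0'),
        c2.continuousAt.eventually_lt continuousAt_const (by simpa using h1')] with t a b c
      exact ⟨a.le, b.le, c.le⟩
    · filter_upwards [e0] with t ht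
      have h2 : (x + t • stdVec i) 2 = x 2 := by simp [stdVec_apply, Ne.symm hi]
      exact ⟨ht.le, h2 ▸ h0, h2 ▸ h1⟩
  rcases hexit with hexit | hexit
  · obtain ⟨t, ht, ht'⟩ := (hev.filter_mono nhdsWithin_le_nhds |>.and
      (self_mem_nhdsWithin : Ioi (0 : ℝ) ∈ 𝓝[>] 0)).exists
    exact hexit t ht' ht
  · obtain ⟨t, ht, ht'⟩ := (hev.filter_mono nhdsWithin_le_nhds |>.and
      (self_mem_nhdsWithin : Iio (0 : ℝ) ∈ 𝓝[<] 0)).exists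
    exact hexit t ht' ht

/-- The divergence theorem on `D` for fields that vanish on the vertical boundary and are tangential
to the horizontal one. -/
theorem integral_div_eq_zero {F : Fin 3 → E3 → ℝ} (hF : ∀ i, ContDiffOn ℝ 1 (F i) D)
    (hv : ∀ i, ∀ x ∈ verticalBoundary, F i x = 0) (hh : ∀ x ∈ horizontalBoundary, F 2 x = 0) :
    ∫ x in D, ∑ i, fderivWithin ℝ (F i) D x (stdVec i) = 0 := by
  rw [integral_finsetSum _ fun i _ => integrableOn_fderivWithin_D (hF i) _]
  refine Finset.sum_eq_zero fun i _ => setIntegral_fderivWithin_eq_zero (hF i) i fun x hx he => ?_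
  rcases mem_boundary_of_exit hx i he with h | ⟨rfl, h⟩
  · exact hv i x h
  · exact hh x h

/-! ### The energy inequality -/

theorem sum_smul_stdVec (y : E3) : ∑ i, y i • stdVec i = y := by
  ext j
  simp [stdVec_apply]

theorem sum_apply_stdVec {F : Type*} [NormedAddCommGroup F] [NormedSpace ℝ F] (A : E3 →L[ℝ] F)
    (y : E3) : ∑ i, y i • A (stdVec i) = A y := by
  conv_rhs => rw [← sum_smul_stdVec y]
  simp

/-- The Laplacian as the sum of the iterated partial derivatives, given the first ones near the
point. -/
theorem laplacian_eq_sum {u : E3 → E3} {A : E3 → E3 →L[ℝ] E3} {x : E3}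
    (hA : fderiv ℝ u =ᶠ[𝓝 x] A) (hd : DifferentiableAt ℝ A x) :
    Δ u x = ∑ i, fderiv ℝ (fun y => A y (stdVec i)) x (stdVec i) := by
  rw [InnerProductSpace.laplacian_eq_iteratedFDeriv_orthonormalBasis u
    (EuclideanSpace.basisFun (Fin 3) ℝ)]
  refine Finset.sum_congr rfl fun i _ => ?_
  rw [iteratedFDeriv_two_apply, hA.fderiv_eq, fderiv_clm_apply hd (differentiableAt_const _)]
  simp [stdVec]

theorem contDiffOn_coord {n : WithTop ℕ∞} {u : E3 → E3} {s : Set E3} (hu : ContDiffOn ℝ n u s)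
    (i : Fin 3) : ContDiffOn ℝ n (fun x => u x i) s :=
  (contDiffOn_piLp 2).1 hu i

/-- The energy inequality at a fixed time: `z` is the time derivative of the difference of two
solutions `w` and `v`. -/
theorem integral_inner_le {v w z : E3 → E3} {P Q : E3 → ℝ} {K : ℝ}
    (hv : ContDiffOn ℝ 2 v D) (hw : ContDiffOn ℝ 2 w D)
    (hP : ContDiffOn ℝ 1 P D) (hQ : ContDiffOn ℝ 1 Q D)
    (hmom : ∀ x ∈ interior D, (Δ w x - fderiv ℝ w x (w x) - ∇ Q x)
      - (Δ v x - fderiv ℝ v x (v x) - ∇ P x) = z x)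
    (hdv : ∀ x ∈ interior D, divergence v x = 0) (hdw : ∀ x ∈ interior D, divergence w x = 0)
    (hnv : NoSlipVertical v) (hnw : NoSlipVertical w)
    (htv : TotalSlipHorizontal v) (htw : TotalSlipHorizontal w)
    (hK : ∀ x ∈ D, ∀ h, ‖fderivWithin ℝ v D x h‖ ≤ K * ‖h‖)
    (hz : IntegrableOn (fun x => inner ℝ (w x - v x) (z x)) D) :
    ∫ x in D, inner ℝ (w x - v x) (z x) ≤ K * ∫ x in D, ‖w x - v x‖ ^ 2 := by
  set u : E3 → E3 := fun x => w x - v x with hu_def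
  have hu : ContDiffOn ℝ 2 u D := hw.sub hv
  have hdu (i : Fin 3) : ContDiffOn ℝ 1 (fun x => fderivWithin ℝ u D x (stdVec i)) D :=
    (hu.fderivWithin uniqueDiffOn_D (m := 1) le_rfl).clm_apply contDiffOn_const
  -- The flux of the energy identity: viscous stress, transport of `‖u‖² / 2` by `w`, and pressure
  -- work.
  set F : Fin 3 → E3 → ℝ := fun i x => inner ℝ (u x) (fderivWithin ℝ u D x (stdVec i))
    - 1 / 2 * (w x i * ‖u x‖ ^ 2) - u x i * (Q x - P x) with hF_def
  have hu1 := hu.of_le (m := 1) one_le_two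
  have hw1 := hw.of_le (m := 1) one_le_two
  have hF (i : Fin 3) : ContDiffOn ℝ 1 (F i) D :=
    ((hu1.inner ℝ (hdu i)).sub (contDiffOn_const.mul ((contDiffOn_coord hw1 i).mul
      (hu1.norm_sq ℝ)))).sub ((contDiffOn_coord hu1 i).mul (hQ.sub hP))
  have hdiv : ∫ x in D, ∑ i, fderivWithin ℝ (F i) D x (stdVec i) = 0 := by
    refine integral_div_eq_zero hF (fun i x hx => ?_) fun x hx => ?_
    · have : u x = 0 := by simp [hu_def, hnw x hx, hnv x hx]
      simp [hF_def, this]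
    -- In `u · ∂₃u` the horizontal terms die by `∂₃u₁ = ∂₃u₂ = 0` and the vertical one by `u₃ = 0`;
    -- the other two fluxes carry a factor `w₃` or `u₃`.
    · obtain ⟨v2, v0, v1⟩ := htv x hx
      obtain ⟨w2, w0, w1⟩ := htw x hx
      have hx' : x ∈ D := hx.1
      have hsub : fderivWithin ℝ u D x = fderivWithin ℝ w D x - fderivWithin ℝ v D x :=
        fderivWithin_fun_sub (uniqueDiffOn_D x hx') (hw.differentiableOn two_ne_zero x hx')
          (hv.differentiableOn two_ne_zero x hx')
      have u2 : u x 2 = 0 := by simp [hu_def, v2, w2]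
      simp [hF_def, w2, u2, PiLp.inner_apply, Fin.sum_univ_three, hsub, v0, v1, w0, w1]
  have hpt : ∀ x ∈ interior D, inner ℝ (u x) (z x)
      ≤ ∑ i, fderivWithin ℝ (F i) D x (stdVec i) + K * ‖u x‖ ^ 2 := by
    intro x hx
    have hxD : D ∈ 𝓝 x := mem_interior_iff_mem_nhds.1 hx
    have hevD : ∀ᶠ y in 𝓝 x, D ∈ 𝓝 y := eventually_mem_nhds_iff.2 hxD
    have hw' := ((hw x (interior_subset hx)).contDiffAt hxD)
    have hv' := ((hv x (interior_subset hx)).contDiffAt hxD)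
    have hu' := ((hu x (interior_subset hx)).contDiffAt hxD)
    have dw := hw'.differentiableAt two_ne_zero
    have dv := hv'.differentiableAt two_ne_zero
    have du := hu'.differentiableAt two_ne_zero
    have dP := ((hP x (interior_subset hx)).contDiffAt hxD).differentiableAt one_ne_zero
    have dQ := ((hQ x (interior_subset hx)).contDiffAt hxD).differentiableAt one_ne_zero
    have ddu (i : Fin 3) := (((hdu i) x (interior_subset hx)).contDiffAt hxD).differentiableAt
      one_ne_zero
    have dA : DifferentiableAt ℝ (fderivWithin ℝ u D) x :=
      (((hu.fderivWithin uniqueDiffOn_D (m := 1) le_rfl) x (interior_subset hx)).contDiffAt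
        hxD).differentiableAt one_ne_zero
    have hlap : Δ u x = ∑ i, fderiv ℝ (fun y => fderivWithin ℝ u D y (stdVec i)) x (stdVec i) :=
      laplacian_eq_sum (hevD.mono fun y hy => (fderivWithin_of_mem_nhds hy).symm) dA
    have hlapsub : Δ u x = Δ w x - Δ v x := hw'.laplacian_sub hv'
    have hfu : fderiv ℝ u x = fderiv ℝ w x - fderiv ℝ v x := fderiv_fun_sub dw dv
    have cw (i : Fin 3) : HasFDerivAt (fun y => w y i)
        ((EuclideanSpace.proj (𝕜 := ℝ) i : E3 →L[ℝ] ℝ).comp (fderiv ℝ w x)) x :=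
      (EuclideanSpace.proj (𝕜 := ℝ) i : E3 →L[ℝ] ℝ).hasFDerivAt.comp x dw.hasFDerivAt
    have cu (i : Fin 3) : HasFDerivAt (fun y => u y i)
        ((EuclideanSpace.proj (𝕜 := ℝ) i : E3 →L[ℝ] ℝ).comp (fderiv ℝ u x)) x :=
      (EuclideanSpace.proj (𝕜 := ℝ) i : E3 →L[ℝ] ℝ).hasFDerivAt.comp x du.hasFDerivAt
    have hFi (i : Fin 3) : fderivWithin ℝ (F i) D x (stdVec i) =
        (inner ℝ (u x) (fderiv ℝ (fun y => fderivWithin ℝ u D y (stdVec i)) x (stdVec i))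
          + ‖fderiv ℝ u x (stdVec i)‖ ^ 2)
        - 1 / 2 * (w x i * (2 * inner ℝ (u x) (fderiv ℝ u x (stdVec i)))
          + ‖u x‖ ^ 2 * fderiv ℝ w x (stdVec i) i)
        - (u x i * (fderiv ℝ Q x (stdVec i) - fderiv ℝ P x (stdVec i))
          + (Q x - P x) * fderiv ℝ u x (stdVec i) i) := by
      rw [fderivWithin_of_mem_nhds hxD]
      have h := (((du.hasFDerivAt.inner ℝ (ddu i).hasFDerivAt).sub
        (((cw i).mul du.hasFDerivAt.norm_sq).const_mul (1 / 2))).sub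
        ((cu i).mul (dQ.hasFDerivAt.sub dP.hasFDerivAt))).fderiv
      have h' := congrArg (fun A : E3 →L[ℝ] ℝ => A (stdVec i)) h
      refine Eq.trans (congrArg (fun A : E3 →L[ℝ] ℝ => A (stdVec i)) ?_) (h'.trans ?_)
      · rfl
      · simp [fderivWithin_of_mem_nhds hxD, fderivInnerCLM_apply]
        ring
    have h1 : ∑ i, w x i * inner ℝ (u x) (fderiv ℝ u x (stdVec i))
        = inner ℝ (u x) (fderiv ℝ u x (w x)) := by
      rw [← sum_apply_stdVec (fderiv ℝ u x) (w x), inner_sum]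
      simp [real_inner_smul_right]
    have hgrad (R : E3 → ℝ) : ∑ i, u x i * fderiv ℝ R x (stdVec i) = inner ℝ (u x) (∇ R x) := by
      rw [real_inner_comm, inner_gradient_left]
      simpa using sum_apply_stdVec (fderiv ℝ R x) (u x)
    have h2w : ∑ i, fderiv ℝ w x (stdVec i) i = 0 := hdw x hx
    have h2u : ∑ i, fderiv ℝ u x (stdVec i) i = 0 := by
      have h2v : ∑ i, fderiv ℝ v x (stdVec i) i = 0 := hdv x hx
      simp [hfu, Finset.sum_sub_distrib, h2w, h2v]
    have hsum : ∑ i, fderivWithin ℝ (F i) D x (stdVec i)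
        = inner ℝ (u x) (Δ u x) + ∑ i, ‖fderiv ℝ u x (stdVec i)‖ ^ 2
          - inner ℝ (u x) (fderiv ℝ u x (w x))
          - (inner ℝ (u x) (∇ Q x) - inner ℝ (u x) (∇ P x)) := by
      rw [hlap, inner_sum, ← h1, ← hgrad Q, ← hgrad P]
      simp only [hFi, Fin.sum_univ_three] at h2w h2u ⊢
      -- The terms left over by the product rule are multiples of `div w` and `div u`.
      linear_combination (-(1 / 2) * ‖u x‖ ^ 2) * h2w - (Q x - P x) * h2u
    have hinner : inner ℝ (u x) (z x) = inner ℝ (u x) (Δ u x)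
        - inner ℝ (u x) (fderiv ℝ u x (w x)) - inner ℝ (u x) (fderiv ℝ v x (u x))
        - (inner ℝ (u x) (∇ Q x) - inner ℝ (u x) (∇ P x)) := by
      rw [← hmom x hx, hlapsub, hfu, ← inner_sub_right, ← inner_sub_right, ← inner_sub_right,
        ← inner_sub_right]
      congr 1
      simp only [hu_def, sub_apply, map_sub]
      abel
    have hKx : -(inner ℝ (u x) (fderiv ℝ v x (u x))) ≤ K * ‖u x‖ ^ 2 := by
      have h3 := hK x (interior_subset hx) (u x)
      rw [fderivWithin_of_mem_nhds hxD] at h3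
      calc -(inner ℝ (u x) (fderiv ℝ v x (u x))) ≤ ‖u x‖ * ‖fderiv ℝ v x (u x)‖ :=
            (neg_le_abs _).trans (abs_real_inner_le_norm _ _)
        _ ≤ ‖u x‖ * (K * ‖u x‖) := by gcongr
        _ = K * ‖u x‖ ^ 2 := by ring
    -- The viscous dissipation enters with a favourable sign and is discarded.
    have hnn : 0 ≤ ∑ i, ‖fderiv ℝ u x (stdVec i)‖ ^ 2 := by positivity
    rw [hsum, hinner]
    linarith
  have hi1 : IntegrableOn (fun x => ∑ i, fderivWithin ℝ (F i) D x (stdVec i)) D :=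
    integrable_finsetSum _ fun i _ => integrableOn_fderivWithin_D (hF i) _
  have hi2 : IntegrableOn (fun x => K * ‖u x‖ ^ 2) D :=
    (continuousOn_const.mul (hu.continuousOn.norm.pow 2)).integrableOn_compact isCompact_D
  calc ∫ x in D, inner ℝ (u x) (z x)
      ≤ ∫ x in D, (∑ i, fderivWithin ℝ (F i) D x (stdVec i) + K * ‖u x‖ ^ 2) :=
        integral_mono_ae hz (Integrable.add hi1 hi2) (ae_interior_D hpt)
    _ = K * ∫ x in D, ‖u x‖ ^ 2 := by
        rw [integral_add hi1 hi2, hdiv, zero_add, integral_const_mul]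

/-! ### Uniqueness of classical solutions -/

theorem uniqueDiffOn_Ico_D (T : ℝ) : UniqueDiffOn ℝ (Ico 0 T ×ˢ D) :=
  (uniqueDiffOn_Ico 0 T).prod uniqueDiffOn_D

theorem contDiffOn_slice {F : Type*} [NormedAddCommGroup F] [NormedSpace ℝ F] {n : WithTop ℕ∞}
    {T t : ℝ} {g : ℝ → E3 → F} (hg : ContDiffOn ℝ n (Function.uncurry g) (Ico 0 T ×ˢ D))
    (ht : t ∈ Ico 0 T) : ContDiffOn ℝ n (g t) D :=
  hg.comp (f := fun x : E3 => (t, x)) (contDiff_const.prodMk contDiff_id).contDiffOn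
    fun _ hx => ⟨ht, hx⟩

theorem hasDerivAt_time {F : Type*} [NormedAddCommGroup F] [NormedSpace ℝ F]
    {T t : ℝ} {g : ℝ → E3 → F} (hg : ContDiffOn ℝ 1 (Function.uncurry g) (Ico 0 T ×ˢ D))
    (ht : t ∈ Ioo 0 T) {x : E3} (hx : x ∈ D) :
    HasDerivAt (fun s => g s x)
      (fderivWithin ℝ (Function.uncurry g) (Ico 0 T ×ˢ D) (t, x) (1, 0)) t := by
  have h1 : HasDerivWithinAt (fun s : ℝ => (s, x)) (1, 0) (Ico 0 T) t :=
    ((hasDerivAt_id t).prodMk (hasDerivAt_const t x)).hasDerivWithinAt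
  have h2 := ((hg.differentiableOn one_ne_zero (t, x)
    ⟨Ioo_subset_Ico_self ht, hx⟩).hasFDerivWithinAt).comp_hasDerivWithinAt t h1
    (show MapsTo (fun s : ℝ => (s, x)) (Ico 0 T) (Ico 0 T ×ˢ D) from fun s hs => ⟨hs, hx⟩)
  exact h2.hasDerivAt (Ico_mem_nhds ht.1 ht.2)

/-- Spatial derivatives thereby inherit bounds from the space-time derivative, which is continuous
on `[0, T) × D`. -/
theorem fderivWithin_slice {F : Type*} [NormedAddCommGroup F] [NormedSpace ℝ F]
    {T t : ℝ} {g : ℝ → E3 → F} (hg : ContDiffOn ℝ 1 (Function.uncurry g) (Ico 0 T ×ˢ D))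
    (ht : t ∈ Ico 0 T) {x : E3} (hx : x ∈ D) :
    fderivWithin ℝ (g t) D x = (fderivWithin ℝ (Function.uncurry g) (Ico 0 T ×ˢ D) (t, x)).comp
      (ContinuousLinearMap.inr ℝ ℝ E3) := by
  have h1 : HasFDerivWithinAt (fun y : E3 => (t, y)) (ContinuousLinearMap.inr ℝ ℝ E3) D x :=
    (hasFDerivAt_prodMk_right t x).hasFDerivWithinAt
  have h2 := ((hg.differentiableOn one_ne_zero (t, x) ⟨ht, hx⟩).hasFDerivWithinAt).comp x h1
    fun y hy => ⟨ht, hy⟩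
  exact h2.fderivWithin (uniqueDiffOn_D x hx)

theorem exists_bound_of_continuousOn {F : Type*} [NormedAddCommGroup F] {T : ℝ} {g : ℝ × E3 → F}
    (hg : ContinuousOn g (Ico 0 T ×ˢ D)) {a b : ℝ} (ha : 0 ≤ a) (hb : b < T) :
    ∃ C, ∀ t ∈ Icc a b, ∀ x ∈ D, ‖g (t, x)‖ ≤ C := by
  have hsub : Icc a b ×ˢ D ⊆ Ico 0 T ×ˢ D :=
    prod_mono (fun t ht => ⟨ha.trans ht.1, ht.2.trans_lt hb⟩) Subset.rfl
  obtain ⟨C, hC⟩ := (isCompact_Icc.prod isCompact_D).exists_bound_of_continuousOn (hg.mono hsub)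
  exact ⟨C, fun t ht x hx => hC (t, x) ⟨ht, hx⟩⟩

/-- The energy of a `C¹` field is continuous up to time `0` and differentiable afterwards. -/
theorem energy_regular {T : ℝ} {u : ℝ → E3 → E3}
    (hu : ContDiffOn ℝ 1 (Function.uncurry u) (Ico 0 T ×ˢ D)) :
    ContinuousOn (fun t => ∫ x in D, ‖u t x‖ ^ 2) (Ico 0 T) ∧
    ∀ t ∈ Ioo 0 T, HasDerivAt (fun t => ∫ x in D, ‖u t x‖ ^ 2)
      (∫ x in D, 2 * inner ℝ (u t x)
        (fderivWithin ℝ (Function.uncurry u) (Ico 0 T ×ˢ D) (t, x) (1, 0))) t := by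
  have hc := hu.continuousOn
  have hslice : ∀ t ∈ Ico 0 T, ContinuousOn (u t) D := fun t ht =>
    (contDiffOn_slice hu ht).continuousOn
  have hd : ContinuousOn (fun y : ℝ × E3 =>
      fderivWithin ℝ (Function.uncurry u) (Ico 0 T ×ˢ D) y (1, 0)) (Ico 0 T ×ˢ D) :=
    (hu.continuousOn_fderivWithin (uniqueDiffOn_Ico_D T) le_rfl).clm_apply continuousOn_const
  have hd2 : ContinuousOn (fun y : ℝ × E3 => 2 * inner ℝ (u y.1 y.2)
      (fderivWithin ℝ (Function.uncurry u) (Ico 0 T ×ˢ D) y (1, 0))) (Ico 0 T ×ˢ D) :=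
    continuousOn_const.mul (hc.inner hd)
  have hsq : ContinuousOn (fun y : ℝ × E3 => ‖u y.1 y.2‖ ^ 2) (Ico 0 T ×ˢ D) := hc.norm.pow 2
  have hmeas : ∀ t ∈ Ico 0 T, AEStronglyMeasurable (fun x => ‖u t x‖ ^ 2) (volume.restrict D) :=
    fun t ht => ((hslice t ht).norm.pow 2).aestronglyMeasurable measurableSet_D
  have hpair (t : ℝ) : Continuous fun x : E3 => (t, x) := by fun_prop
  constructor
  · intro t ht
    -- Stopping strictly before `T` leaves a compact space-time region, where a constant serves as
    -- dominating function.
    obtain ⟨b, htb, hbT⟩ := exists_between ht.2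
    obtain ⟨C, hC⟩ := exists_bound_of_continuousOn hsq le_rfl hbT
    have hmem : Icc 0 b ∈ 𝓝[Ico 0 T] t := by
      filter_upwards [self_mem_nhdsWithin, mem_nhdsWithin_of_mem_nhds (Iio_mem_nhds htb)]
        with s hs hs' using ⟨hs.1, le_of_lt hs'⟩
    refine continuousWithinAt_of_dominated (bound := fun _ => C) ?_ ?_ (integrable_const _) ?_
    · filter_upwards [self_mem_nhdsWithin] with s hs using hmeas s hs
    · filter_upwards [hmem] with s hs
      exact (ae_restrict_iff' measurableSet_D).2 (ae_of_all _ fun x hx => hC s hs x hx)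
    · refine (ae_restrict_iff' measurableSet_D).2 (ae_of_all _ fun x hx => ?_)
      exact (hsq.comp (f := fun s : ℝ => (s, x)) (by fun_prop) fun s hs => ⟨hs, hx⟩) t ht
  · intro t ht
    obtain ⟨a, ha0, hat⟩ := exists_between ht.1
    obtain ⟨b, htb, hbT⟩ := exists_between ht.2
    obtain ⟨C, hC⟩ := exists_bound_of_continuousOn hd2 ha0.le hbT
    have hsub : Icc a b ⊆ Ioo 0 T := fun s hs => ⟨ha0.trans_le hs.1, hs.2.trans_lt hbT⟩
    refine (hasDerivAt_integral_of_dominated_loc_of_deriv_le (μ := volume.restrict D)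
      (F := fun t x => ‖u t x‖ ^ 2) (bound := fun _ => C) (F' := fun t x => 2 * inner ℝ (u t x)
        (fderivWithin ℝ (Function.uncurry u) (Ico 0 T ×ˢ D) (t, x) (1, 0)))
      (Icc_mem_nhds hat htb) ?_ ?_ ?_ ?_ (integrable_const _) ?_).2
    · filter_upwards [Ico_mem_nhds ht.1 ht.2] with s hs using hmeas s hs
    · exact ((hslice t (Ioo_subset_Ico_self ht)).norm.pow 2).integrableOn_compact isCompact_D
    · exact (hd2.comp (hpair t).continuousOn fun x hx =>
        ⟨Ioo_subset_Ico_self ht, hx⟩).aestronglyMeasurable measurableSet_D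
    · exact (ae_restrict_iff' measurableSet_D).2 (ae_of_all _ fun x hx s hs => hC s hs x hx)
    · refine (ae_restrict_iff' measurableSet_D).2 (ae_of_all _ fun x hx s hs => ?_)
      exact (hasDerivAt_time hu (hsub hs) hx).norm_sq

/-- Classical solutions with the same force and the same initial velocity have the same velocity. -/
theorem IsClassicalSolution.unique {T : ℝ} {f v w : ℝ → E3 → E3} {P Q : ℝ → E3 → ℝ}
    (hv : IsClassicalSolution T f v P) (hw : IsClassicalSolution T f w Q)
    (h0 : ∀ x ∈ D, w 0 x = v 0 x) : ∀ t ∈ Ico 0 T, ∀ x ∈ D, w t x = v t x := by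
  intro S hS
  have hv1 := hv.velocity_regular.of_le (m := 1) one_le_two
  have hw1 := hw.velocity_regular.of_le (m := 1) one_le_two
  set u : ℝ → E3 → E3 := fun t x => w t x - v t x with hu_def
  have hu : ContDiffOn ℝ 1 (Function.uncurry u) (Ico 0 T ×ˢ D) := hw1.sub hv1
  obtain ⟨hEc, hEd⟩ := energy_regular hu
  set E : ℝ → ℝ := fun t => ∫ x in D, ‖u t x‖ ^ 2 with hE
  -- `K` may depend on `S`: the gradient of `v` need not stay bounded up to `T`.
  obtain ⟨K, hK⟩ := exists_bound_of_continuousOn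
    (hv1.continuousOn_fderivWithin (uniqueDiffOn_Ico_D T) le_rfl) le_rfl hS.2
  have hineq : ∀ t ∈ Ioo 0 S, (∫ x in D, 2 * inner ℝ (u t x)
      (fderivWithin ℝ (Function.uncurry u) (Ico 0 T ×ˢ D) (t, x) (1, 0))) ≤ 2 * K * E t := by
    intro t ht
    have ht' : t ∈ Ioo 0 T := ⟨ht.1, ht.2.trans hS.2⟩
    have ht'' := Ioo_subset_Ico_self ht'
    rw [integral_const_mul, mul_assoc]
    refine mul_le_mul_of_nonneg_left ?_ zero_le_two
    refine integral_inner_le (contDiffOn_slice hv.velocity_regular ht'')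
      (contDiffOn_slice hw.velocity_regular ht'') (contDiffOn_slice hv.pressure_regular ht'')
      (contDiffOn_slice hw.pressure_regular ht'') (fun x hx => ?_)
      (hv.incompressible t ht') (hw.incompressible t ht') (hv.no_slip t ht'') (hw.no_slip t ht'')
      (hv.total_slip t ht'') (hw.total_slip t ht'') (fun x hx h => ?_) ?_
    · have hxD := interior_subset hx
      have e1 := (hasDerivAt_time hu ht' hxD).deriv
      have e2 : deriv (fun s => u s x) t = deriv (fun s => w s x) t - deriv (fun s => v s x) t :=
        deriv_fun_sub (hasDerivAt_time hw1 ht' hxD).differentiableAt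
          (hasDerivAt_time hv1 ht' hxD).differentiableAt
      have m1 := hv.momentum t ht' x hx
      have m2 := hw.momentum t ht' x hx
      rw [← e1, e2, sub_eq_iff_eq_add.1 m1, sub_eq_iff_eq_add.1 m2]
      abel
    · rw [fderivWithin_slice hv1 ht'' hx]
      calc ‖fderivWithin ℝ (Function.uncurry v) (Ico 0 T ×ˢ D) (t, x) (0, h)‖
          ≤ ‖fderivWithin ℝ (Function.uncurry v) (Ico 0 T ×ˢ D) (t, x)‖ * ‖((0 : ℝ), h)‖ :=
            ContinuousLinearMap.le_opNorm _ _
        _ ≤ K * ‖h‖ := by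
            have : ‖((0 : ℝ), h)‖ = ‖h‖ := by simp [Prod.norm_def]
            rw [this]
            gcongr
            exact hK t ⟨ht.1.le, ht.2.le⟩ x hx
    · refine ContinuousOn.integrableOn_compact isCompact_D ?_
      refine (contDiffOn_slice hu ht'').continuousOn.inner ?_
      exact ((hu.continuousOn_fderivWithin (uniqueDiffOn_Ico_D T) le_rfl).comp
        (f := fun x : E3 => (t, x)) (by fun_prop) fun x hx => ⟨ht'', hx⟩).clm_apply
        continuousOn_const
  have hsub : Icc 0 S ⊆ Ico 0 T := fun s hs => ⟨hs.1, hs.2.trans_lt hS.2⟩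
  have hder : ∀ t ∈ Ioo 0 S, HasDerivAt (fun t => E t * Real.exp (-(2 * K) * t))
      ((∫ x in D, 2 * inner ℝ (u t x)
        (fderivWithin ℝ (Function.uncurry u) (Ico 0 T ×ˢ D) (t, x) (1, 0)))
        * Real.exp (-(2 * K) * t) + E t * (Real.exp (-(2 * K) * t) * (-(2 * K)))) t := fun t ht => by
    have h1 : HasDerivAt (fun t : ℝ => -(2 * K) * t) (-(2 * K)) t := by
      simpa using (hasDerivAt_id t).const_mul (-(2 * K))
    exact (hEd t ⟨ht.1, ht.2.trans hS.2⟩).mul h1.exp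
  -- Grönwall's inequality, through the integrating factor of `E' ≤ 2 K E`.
  have hanti : AntitoneOn (fun t => E t * Real.exp (-(2 * K) * t)) (Icc 0 S) := by
    refine antitoneOn_of_deriv_nonpos (convex_Icc 0 S)
      ((hEc.mono hsub).mul (by fun_prop)) (fun t ht => ?_) fun t ht => ?_
    · rw [interior_Icc] at ht
      exact (hder t ht).differentiableAt.differentiableWithinAt
    · rw [interior_Icc] at ht
      rw [(hder t ht).deriv]
      have := mul_le_mul_of_nonneg_right (hineq t ht) (Real.exp_pos (-(2 * K) * t)).le
      linarith
  have hE0 : E 0 = 0 := by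
    have : ∀ x ∈ D, ‖u 0 x‖ ^ 2 = 0 := fun x hx => by simp [hu_def, h0 x hx]
    rw [hE]
    simp only [setIntegral_congr_fun measurableSet_D this, integral_zero]
  have hES : E S ≤ 0 := by
    have h := hanti (left_mem_Icc.2 hS.1) (right_mem_Icc.2 hS.1) hS.1
    simp only [hE0, zero_mul] at h
    exact nonpos_of_mul_nonpos_left h (Real.exp_pos _)
  have hcS := (contDiffOn_slice hu hS).continuousOn
  have hzero : (fun x => ‖u S x‖ ^ 2) =ᵐ[volume.restrict D] 0 :=
    (integral_eq_zero_iff_of_nonneg (fun x => sq_nonneg _)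
      ((hcS.norm.pow 2).integrableOn_compact isCompact_D)).1
      (hES.antisymm (integral_nonneg fun x => sq_nonneg _))
  -- Almost everywhere becomes everywhere because the difference is continuous and `D` lies in the
  -- closure of its interior.
  have heq := Measure.eqOn_of_ae_eq hzero (hcS.norm.pow 2) continuousOn_const
    D_subset_closure_interior
  intro x hx
  simpa [hu_def, sub_eq_zero] using heq hx

/-! ### Mixed Lebesgue norms of singular fields -/

/-- The squared distance to the axis of the cylinder. -/
noncomputable def rho (x : E3) : ℝ := x 0 ^ 2 + x 1 ^ 2

theorem rho_nonneg (x : E3) : 0 ≤ rho x := by unfold rho; positivity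

theorem rho_le_one {x : E3} (hx : x ∈ D) : rho x ≤ 1 := hx.1

/-- Removes the coordinate planes, where the convention `0 ^ (-c) = 0` for `c ≠ 0` would make the
bound of `rpow_add_rho_le` false. -/
theorem ae_coord_ne_zero : ∀ᵐ x : E3, ∀ i, x i ≠ 0 := by
  rw [ae_all_iff]
  intro i
  have h := Measure.addHaar_submodule (volume : Measure E3)
    (LinearMap.ker (EuclideanSpace.proj (𝕜 := ℝ) i : E3 →L[ℝ] ℝ).toLinearMap) fun h => by
      have : stdVec i ∈ LinearMap.ker (EuclideanSpace.proj (𝕜 := ℝ) i : E3 →L[ℝ] ℝ).toLinearMap :=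
        h ▸ Submodule.mem_top
      simp [stdVec] at this
  filter_upwards [measure_eq_zero_iff_ae_notMem.1 h] with x hx h0
  exact hx (by simpa using h0)

theorem integrableOn_abs_rpow {r : ℝ} (hr : -1 < r) :
    IntegrableOn (fun x : ℝ => |x| ^ r) (Icc (-1) 1) := by
  have h1 : IntervalIntegrable (fun x : ℝ => |x| ^ r) volume 0 1 := by
    refine (intervalIntegral.intervalIntegrable_rpow' hr).congr fun x hx => ?_
    rw [uIoc_of_le zero_le_one] at hx
    simp only [abs_of_pos hx.1]
  have h2 : IntervalIntegrable (fun x : ℝ => |x| ^ r) volume (-1) 0 := by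
    rw [IntervalIntegrable.iff_comp_neg]
    simpa using h1.symm
  have h3 := h2.trans h1
  rwa [intervalIntegrable_iff_integrableOn_Icc_of_le (by norm_num)] at h3

/-- A product of small negative powers of the coordinates is integrable on `D`. -/
theorem integrableOn_prod_abs_rpow {r : ℝ} (hr : -1 < r) :
    IntegrableOn (fun x : E3 => ∏ i, |x i| ^ r) D := by
  have hsub : D ⊆ {x : E3 | ∀ i, x i ∈ Icc (-1 : ℝ) 1} := fun x hx i => by
    obtain ⟨h, h0, h1⟩ := hx
    refine abs_le.1 ?_
    fin_cases i
    · exact abs_le_one_iff_mul_self_le_one.2 (by simp; nlinarith [sq_nonneg (x 1)])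
    · exact abs_le_one_iff_mul_self_le_one.2 (by simp; nlinarith [sq_nonneg (x 0)])
    · exact abs_le.2 ⟨by simp; linarith, h1⟩
  refine IntegrableOn.mono_set ?_ hsub
  rw [← (PiLp.volume_preserving_toLp (Fin 3)).integrableOn_comp_preimage
    (MeasurableEquiv.toLp 2 (Fin 3 → ℝ)).measurableEmbedding]
  have hset : WithLp.toLp 2 ⁻¹' {x : E3 | ∀ i, x i ∈ Icc (-1 : ℝ) 1}
      = Set.univ.pi fun _ : Fin 3 => Icc (-1 : ℝ) 1 := by
    ext x; simp only [mem_preimage, mem_ofPred_eq, Set.mem_univ_pi]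
  rw [hset, IntegrableOn, volume_pi, Measure.restrict_pi_pi]
  exact Integrable.fintype_prod (f := fun _ : Fin 3 => fun x : ℝ => |x| ^ r)
    fun i => integrableOn_abs_rpow hr

/-- The `p`-th power of the product is again a product, with exponents `-c p > -1`, and each factor
is integrable on `[-1, 1]`. -/
theorem memLp_prod_abs_rpow {c : ℝ} {p : ℝ≥0∞} (hp0 : p ≠ 0) (hp : p ≠ ⊤)
    (hc : c * p.toReal < 1) :
    MemLp (fun x : E3 => ∏ i, |x i| ^ (-c)) p (volume.restrict D) := by
  have hm : Measurable fun x : E3 => ∏ i, |x i| ^ (-c) := by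
    refine Finset.measurable_fun_prod _ fun i _ => ?_
    have : Measurable fun x : E3 => x i := by fun_prop
    exact this.abs.pow_const _
  rw [← integrable_norm_rpow_iff hm.aestronglyMeasurable hp0 hp]
  refine (integrableOn_prod_abs_rpow (r := -(c * p.toReal)) (by linarith)).congr
    (ae_of_all _ fun x => ?_)
  have hnn : ∀ i ∈ Finset.univ, 0 ≤ |x i| ^ (-c) := fun i _ => Real.rpow_nonneg (abs_nonneg _) _
  simp only [Real.norm_of_nonneg (Finset.prod_nonneg hnn), ← Real.finsetProd_rpow _ _ hnn]
  refine Finset.prod_congr rfl fun i _ => ?_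
  rw [← Real.rpow_mul (abs_nonneg _), neg_mul]

/-- The alternative `a = 0` covers `q = ⊤`, as needed for `L^∞_t L^2_x`. -/
theorem memLp_sub_rpow {T a : ℝ} {q : ℝ≥0∞} (hT : 0 < T) (hq0 : q ≠ 0)
    (hq : a = 0 ∨ (q ≠ ⊤ ∧ a * q.toReal < 1)) :
    MemLp (fun t : ℝ => (T - t) ^ (-a)) q (volume.restrict (Ioo 0 T)) := by
  rcases hq with rfl | ⟨hq, ha⟩
  · simpa using memLp_const (1 : ℝ)
  have hm : Measurable fun t : ℝ => (T - t) ^ (-a) :=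
    (measurable_const.sub measurable_id).pow_const _
  rw [← integrable_norm_rpow_iff hm.aestronglyMeasurable hq0 hq]
  have h := (intervalIntegral.intervalIntegrable_rpow' (a := T) (b := 0)
    (r := -(a * q.toReal)) (by linarith)).comp_sub_left T
  rw [sub_self, sub_zero, intervalIntegrable_iff_integrableOn_Ioo_of_le hT.le] at h
  refine (integrableOn_congr_fun (fun t ht => ?_) measurableSet_Ioo).1 h
  have h0 : 0 ≤ T - t := by linarith [ht.2]
  simp only [Real.norm_of_nonneg (Real.rpow_nonneg h0 _)]
  rw [← Real.rpow_mul h0, neg_mul]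

/-- The singular weight splits into a power of the time to blow-up and powers of the
coordinates. -/
theorem rpow_add_rho_le {τ a c : ℝ} (hτ : 0 < τ) (ha : 0 ≤ a) (hc : 0 ≤ c) {x : E3} (hx : x ∈ D)
    (hx0 : ∀ i, x i ≠ 0) :
    (τ + rho x) ^ (-(a + c)) ≤ τ ^ (-a) * ∏ i, |x i| ^ (-c) := by
  have hρ := rho_nonneg x
  have hy : 0 < τ + rho x := by linarith
  have hpos : 0 < ∏ i, |x i| := Finset.prod_pos fun i _ => abs_pos.2 (hx0 i)
  -- The bound `|x₁||x₂| ≤ ρ` does the work. The factor `|x₃| ≤ 1` is harmless and makes the weight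
  -- a product over all coordinates.
  have hprod : ∏ i, |x i| ≤ τ + rho x := by
    have h2 : |x 2| ≤ 1 := abs_le.2 ⟨by linarith [hx.2.1], hx.2.2⟩
    have h01 : |x 0| * |x 1| ≤ rho x := by
      unfold rho
      nlinarith [sq_nonneg (|x 0| - |x 1|), sq_abs (x 0), sq_abs (x 1), abs_nonneg (x 0),
        abs_nonneg (x 1), mul_nonneg (abs_nonneg (x 0)) (abs_nonneg (x 1))]
    rw [Fin.prod_univ_three]
    calc |x 0| * |x 1| * |x 2| ≤ |x 0| * |x 1| * 1 := by gcongr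
      _ ≤ τ + rho x := by linarith
  rw [neg_add, Real.rpow_add hy, Real.finsetProd_rpow _ _ fun i _ => abs_nonneg _]
  gcongr ?_ * ?_
  · exact Real.rpow_le_rpow_of_nonpos hτ (by linarith) (by linarith)
  · exact Real.rpow_le_rpow_of_nonpos hpos hprod (by linarith)

/-- A field dominated by `(T - t + ρ)^{-(a + c)}` lies in `L^q_t L^p_x` if `a q < 1` and
`c p < 1`. -/
theorem memLqLp_of_le {F : Type*} [NormedAddCommGroup F] {T a c C : ℝ} {q p : ℝ≥0∞}
    {g : ℝ → E3 → F} (hT : 0 < T) (hg : ContinuousOn (Function.uncurry g) (Ioo 0 T ×ˢ D))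
    (ha : 0 ≤ a) (hc : 0 ≤ c) (hq0 : q ≠ 0) (hq : a = 0 ∨ (q ≠ ⊤ ∧ a * q.toReal < 1))
    (hp0 : p ≠ 0) (hp : p ≠ ⊤) (hcp : c * p.toReal < 1)
    (hle : ∀ t ∈ Ioo 0 T, ∀ x ∈ D, ‖g t x‖ ≤ C * (T - t + rho x) ^ (-(a + c))) :
    MemLqLp T q p g := by
  refine ⟨?_, ?_⟩
  · rw [Measure.prod_restrict]
    exact hg.aestronglyMeasurable (measurableSet_Ioo.prod measurableSet_D)
  have hK := memLp_prod_abs_rpow hp0 hp hcp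
  set K : E3 → ℝ := fun x => ∏ i, |x i| ^ (-c) with hKdef
  set N := (eLpNorm K p (volume.restrict D)).toReal with hN
  have hNe : eLpNorm K p (volume.restrict D) = ‖N‖ₑ := by
    rw [hN, Real.enorm_eq_ofReal ENNReal.toReal_nonneg, ENNReal.ofReal_toReal hK.2.ne]
  have h1 : ∀ t ∈ Ioo 0 T,
      eLpNorm (g t) p (volume.restrict D) ≤ ‖(C * N) * (T - t) ^ (-a)‖ₑ := by
    intro t ht
    have hτ : 0 < T - t := by linarith [ht.2]
    have h2 : eLpNorm (g t) p (volume.restrict D)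
        ≤ eLpNorm ((C * (T - t) ^ (-a)) • K) p (volume.restrict D) := by
      refine eLpNorm_mono_ae ?_
      filter_upwards [ae_restrict_mem measurableSet_D, ae_restrict_of_ae ae_coord_ne_zero]
        with x hx hx0
      refine (hle t ht x hx).trans ?_
      have hy : 0 < T - t + rho x := by linarith [rho_nonneg x]
      have hC : 0 ≤ C := nonneg_of_mul_nonneg_left ((norm_nonneg _).trans (hle t ht x hx))
        (Real.rpow_pos_of_pos hy _)
      calc C * (T - t + rho x) ^ (-(a + c)) ≤ C * ((T - t) ^ (-a) * K x) := by
            gcongr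
            exact rpow_add_rho_le hτ ha hc hx hx0
        _ ≤ ‖((C * (T - t) ^ (-a)) • K) x‖ := by
            rw [Pi.smul_apply, smul_eq_mul, ← mul_assoc]
            exact Real.le_norm_self _
    rwa [eLpNorm_const_smul, hNe, ← enorm_mul, mul_right_comm] at h2
  calc eLpNorm (fun t => eLpNorm (g t) p (volume.restrict D)) q (volume.restrict (Ioo 0 T))
      ≤ eLpNorm (fun t => (C * N) * (T - t) ^ (-a)) q (volume.restrict (Ioo 0 T)) := by
        refine eLpNorm_mono_enorm_ae ?_
        filter_upwards [ae_restrict_mem measurableSet_Ioo] with t ht using h1 t ht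
    _ < ⊤ := ((memLp_sub_rpow hT hq0 hq).const_mul (C * N)).2

/-- The essential supremum over `D` of a continuous field bounds its values at interior points. -/
theorem enorm_le_eLpNorm_top {F : Type*} [NormedAddCommGroup F] {g : E3 → F} (hg : Continuous g)
    {x : E3} (hx : x ∈ interior D) : ‖g x‖ₑ ≤ eLpNorm g ⊤ (volume.restrict D) := by
  rw [eLpNorm_exponent_top]
  by_contra! hlt
  -- If the bound failed at `x`, continuity would make it fail on a nonempty open subset of `D`,
  -- which has positive measure.
  have hopen : IsOpen ({y | eLpNormEssSup g (volume.restrict D) < ‖g y‖ₑ} ∩ interior D) :=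
    (isOpen_lt continuous_const hg.enorm).inter isOpen_interior
  have hpos := hopen.measure_pos volume ⟨x, hlt, hx⟩
  have hae : ∀ᵐ y ∂(volume.restrict (interior D)),
      ‖g y‖ₑ ≤ eLpNormEssSup g (volume.restrict D) :=
    ae_restrict_of_ae_restrict_of_subset interior_subset ae_le_eLpNormEssSup
  rw [ae_restrict_iff' isOpen_interior.measurableSet, ae_iff] at hae
  refine hpos.ne' (measure_mono_null (fun y hy => ?_) hae)
  simp only [mem_ofPred_eq, not_forall, not_le]
  exact ⟨hy.2, hy.1⟩

/-! ### Swirling flows -/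

/-- The infinitesimal rotation `(x₁, x₂, x₃) ↦ (-x₂, x₁, 0)` about the axis of the cylinder. -/
noncomputable def rot : E3 →L[ℝ] E3 :=
  (EuclideanSpace.proj (𝕜 := ℝ) 0 : E3 →L[ℝ] ℝ).smulRight (stdVec 1)
    - (EuclideanSpace.proj (𝕜 := ℝ) 1 : E3 →L[ℝ] ℝ).smulRight (stdVec 0)

/-- The derivative of `rho`. -/
noncomputable def rhoDeriv (x : E3) : E3 →L[ℝ] ℝ :=
  (2 * x 0) • (EuclideanSpace.proj (𝕜 := ℝ) 0 : E3 →L[ℝ] ℝ)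
    + (2 * x 1) • (EuclideanSpace.proj (𝕜 := ℝ) 1 : E3 →L[ℝ] ℝ)

theorem rot_apply_zero (x : E3) : rot x 0 = -x 1 := by simp [rot, stdVec_apply]

theorem rot_apply_one (x : E3) : rot x 1 = x 0 := by simp [rot, stdVec_apply]

theorem rot_apply_two (x : E3) : rot x 2 = 0 := by simp [rot, stdVec_apply]

theorem rhoDeriv_apply (x h : E3) : rhoDeriv x h = 2 * x 0 * h 0 + 2 * x 1 * h 1 := by
  simp [rhoDeriv]

theorem norm_rot (x : E3) : ‖rot x‖ = √(rho x) := by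
  rw [EuclideanSpace.norm_eq]
  congr 1
  simp only [Fin.sum_univ_three, rot_apply_zero, rot_apply_one, rot_apply_two, Real.norm_eq_abs,
    sq_abs, rho]
  ring

theorem sqrt_rho_le_norm (x : E3) : √(rho x) ≤ ‖x‖ := by
  rw [EuclideanSpace.norm_eq]
  refine Real.sqrt_le_sqrt ?_
  simp only [Fin.sum_univ_three, Real.norm_eq_abs, sq_abs, rho]
  nlinarith [sq_nonneg (x 2)]

theorem abs_rhoDeriv_le (x h : E3) : |rhoDeriv x h| ≤ 2 * √(rho x) * ‖h‖ := by
  refine le_trans ?_ (mul_le_mul_of_nonneg_left (sqrt_rho_le_norm h) (by positivity))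
  rw [mul_assoc, ← Real.sqrt_mul (rho_nonneg x), rhoDeriv_apply]
  have : |x 0 * h 0 + x 1 * h 1| ≤ √(rho x * rho h) := by
    refine Real.abs_le_sqrt ?_
    unfold rho
    nlinarith [sq_nonneg (x 0 * h 1 - x 1 * h 0)]
  calc |2 * x 0 * h 0 + 2 * x 1 * h 1| = |2 * (x 0 * h 0 + x 1 * h 1)| := by ring_nf
    _ = 2 * |x 0 * h 0 + x 1 * h 1| := by rw [abs_mul, abs_two]
    _ ≤ _ := by gcongr

theorem hasFDerivAt_rho (x : E3) : HasFDerivAt rho (rhoDeriv x) x := by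
  have h0 := (EuclideanSpace.proj (𝕜 := ℝ) 0 : E3 →L[ℝ] ℝ).hasFDerivAt (x := x)
  have h1 := (EuclideanSpace.proj (𝕜 := ℝ) 1 : E3 →L[ℝ] ℝ).hasFDerivAt (x := x)
  have h := (h0.pow 2).add (h1.pow 2)
  refine HasFDerivAt.congr_fderiv (f := rho) h ?_
  ext y
  simp [rhoDeriv]

/-- The derivative of the swirling field `φ(ρ) rot`, where `a` and `a'` are the values of `φ` and of
its derivative. -/
noncomputable def swirlDeriv (a a' : ℝ) (x : E3) : E3 →L[ℝ] E3 :=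
  a • rot + a' • (rhoDeriv x).smulRight (rot x)

theorem swirlDeriv_apply (a a' : ℝ) (x h : E3) :
    swirlDeriv a a' x h = a • rot h + (a' * rhoDeriv x h) • rot x := by
  simp [swirlDeriv, mul_smul]

theorem hasFDerivAt_swirl {φ : ℝ → ℝ} {φ' : ℝ} {x : E3} (h : HasDerivAt φ φ' (rho x)) :
    HasFDerivAt (fun y => φ (rho y) • rot y) (swirlDeriv (φ (rho x)) φ' x) x := by
  refine ((h.comp_hasFDerivAt x (hasFDerivAt_rho x)).smul rot.hasFDerivAt).congr_fderiv ?_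
  ext1 y
  simp [swirlDeriv_apply]

theorem rot_stdVec (i : Fin 3) : rot (stdVec i) = ![stdVec 1, -stdVec 0, 0] i := by
  ext j
  fin_cases i <;> fin_cases j <;> simp [rot, stdVec_apply]

/-- `rot` is trace free, and `rot x` is tangent to the level sets of `rho`. -/
theorem divergence_swirl {φ : ℝ → ℝ} {φ' : ℝ} {x : E3} (h : HasDerivAt φ φ' (rho x)) :
    divergence (fun y => φ (rho y) • rot y) x = 0 := by
  rw [divergence, (hasFDerivAt_swirl h).fderiv]
  simp [Fin.sum_univ_three, swirlDeriv_apply, rhoDeriv_apply, rot_apply_zero, rot_apply_one,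
    rot_apply_two, stdVec_apply]
  ring

/-- Since `rot` is linear, only two terms survive: `Δ(φ(ρ)) = 4 ρ φ'' + 4 φ'`, and the cross term `2
φ' rot(∇ρ) = 4 φ' rot x`. -/
theorem laplacian_swirl {φ φ' : ℝ → ℝ} {φ'' : ℝ} {x : E3}
    (h : ∀ s, 0 ≤ s → HasDerivAt φ (φ' s) s) (h' : HasDerivAt φ' φ'' (rho x)) :
    Δ (fun y => φ (rho y) • rot y) x = (4 * rho x * φ'' + 8 * φ' (rho x)) • rot x := by
  have hfd : fderiv ℝ (fun y => φ (rho y) • rot y)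
      = fun y => swirlDeriv (φ (rho y)) (φ' (rho y)) y :=
    funext fun y => (hasFDerivAt_swirl (h _ (rho_nonneg y))).fderiv
  have hA (i : Fin 3) : HasFDerivAt
      (fun y => φ (rho y) • rot (stdVec i) + rhoDeriv y (stdVec i) • (φ' (rho y) • rot y))
      ((φ' (rho x) • rhoDeriv x).smulRight (rot (stdVec i))
        + (rhoDeriv x (stdVec i) • swirlDeriv (φ' (rho x)) φ'' x
          + (rhoDeriv (stdVec i)).smulRight (φ' (rho x) • rot x))) x := by
    have hlin : HasFDerivAt (fun y => rhoDeriv y (stdVec i)) (rhoDeriv (stdVec i)) x := by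
      have : (fun y => rhoDeriv y (stdVec i)) = rhoDeriv (stdVec i) := by
        ext y; simp only [rhoDeriv_apply]; ring
      rw [this]
      exact (rhoDeriv (stdVec i)).hasFDerivAt
    exact (((h _ (rho_nonneg x)).comp_hasFDerivAt x (hasFDerivAt_rho x)).smul_const _).add
      (hlin.smul (hasFDerivAt_swirl h'))
  have hdiff : DifferentiableAt ℝ (fun y => swirlDeriv (φ (rho y)) (φ' (rho y)) y) x := by
    have hρ : ContDiff ℝ 1 rhoDeriv := by unfold rhoDeriv; fun_prop
    have hr := (hρ.smulRight rot.contDiff).differentiable one_ne_zero x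
    have h1 := ((h _ (rho_nonneg x)).comp_hasFDerivAt x (hasFDerivAt_rho x)).differentiableAt
    have h2 := (h'.comp_hasFDerivAt x (hasFDerivAt_rho x)).differentiableAt
    exact (h1.smul_const rot).add (h2.smul hr)
  rw [laplacian_eq_sum (Eventually.of_forall fun y => congrFun hfd y) hdiff]
  have hfun (i : Fin 3) : (fun y => swirlDeriv (φ (rho y)) (φ' (rho y)) y (stdVec i))
      = fun y => φ (rho y) • rot (stdVec i) + rhoDeriv y (stdVec i) • (φ' (rho y) • rot y) := by
    ext1 y
    rw [swirlDeriv_apply, smul_smul, mul_comm (φ' _)]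
  simp only [hfun, (hA _).fderiv, Fin.sum_univ_three]
  ext j
  fin_cases j <;>
  simp [swirlDeriv_apply, rhoDeriv_apply, rot_apply_zero, rot_apply_one,
    rot_apply_two, stdVec_apply, rho] <;> ring

/-- The convective term of a swirling flow is balanced by a radial pressure. -/
theorem convection_swirl {φ ψ : ℝ → ℝ} {φ' : ℝ} {x : E3} (h : HasDerivAt φ φ' (rho x))
    (hψ : HasDerivAt ψ (φ (rho x) ^ 2 / 2) (rho x)) :
    fderiv ℝ (fun y => φ (rho y) • rot y) x (φ (rho x) • rot x) + ∇ (fun y => ψ (rho y)) x = 0 := by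
  -- The pressure gradient is `φ²` times the horizontal part of `x`. The convective term is its
  -- negative, because `rot ∘ rot` is minus the horizontal projection and `ρ` is constant along `rot
  -- x`.
  have hg : HasGradientAt (fun y => ψ (rho y)) ((φ (rho x) ^ 2) • (x - x 2 • stdVec 2)) x := by
    rw [hasGradientAt_iff_hasFDerivAt]
    refine (hψ.comp_hasFDerivAt x (hasFDerivAt_rho x)).congr_fderiv ?_
    ext y
    simp [rhoDeriv_apply, PiLp.inner_apply, Fin.sum_univ_three, stdVec_apply]
    ring
  rw [hg.gradient, (hasFDerivAt_swirl h).fderiv, swirlDeriv_apply]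
  ext j
  fin_cases j <;>
  simp [rhoDeriv_apply, rot_apply_zero, rot_apply_one, rot_apply_two, stdVec_apply] <;> ring

/-! ### The radial profile -/

/-- The angular velocity at squared distance `s` from the axis, at time `τ` before blow-up. -/
noncomputable def profile (b τ s : ℝ) : ℝ := (1 - s) * (τ + s) ^ (-b)

/-- The derivative of `profile` in `s`. -/
noncomputable def profileDeriv (b τ s : ℝ) : ℝ :=
  -(τ + s) ^ (-b) - b * (1 - s) * (τ + s) ^ (-b - 1)

/-- The second derivative of `profile` in `s`. -/
noncomputable def profileDeriv2 (b τ s : ℝ) : ℝ :=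
  2 * b * (τ + s) ^ (-b - 1) + b * (b + 1) * (1 - s) * (τ + s) ^ (-b - 1 - 1)

/-- A primitive of `profile ^ 2 / 2` in `s`. -/
noncomputable def pressureProfile (b τ s : ℝ) : ℝ :=
  ((1 + τ) ^ 2 * ((τ + s) ^ (1 - 2 * b) / (1 - 2 * b))
    - 2 * (1 + τ) * ((τ + s) ^ (2 - 2 * b) / (2 - 2 * b))
    + (τ + s) ^ (3 - 2 * b) / (3 - 2 * b)) / 2

/-- The angular component of the force, divided by the distance to the axis. -/
noncomputable def forceProfile (b τ s : ℝ) : ℝ :=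
  4 * s * profileDeriv2 b τ s + 8 * profileDeriv b τ s - b * (1 - s) * (τ + s) ^ (-b - 1)

theorem hasDerivAt_add_rpow {τ s : ℝ} (c : ℝ) (h : 0 < τ + s) :
    HasDerivAt (fun s => (τ + s) ^ c) (c * (τ + s) ^ (c - 1)) s := by
  simpa using ((hasDerivAt_id s).const_add τ).rpow_const (p := c) (Or.inl h.ne')

theorem hasDerivAt_profile (b : ℝ) {τ s : ℝ} (h : 0 < τ + s) :
    HasDerivAt (profile b τ) (profileDeriv b τ s) s := by
  refine (((hasDerivAt_id s).const_sub 1).mul (hasDerivAt_add_rpow (-b) h)).congr_deriv ?_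
  simp only [profileDeriv, id]
  ring

theorem hasDerivAt_profileDeriv (b : ℝ) {τ s : ℝ} (h : 0 < τ + s) :
    HasDerivAt (profileDeriv b τ) (profileDeriv2 b τ s) s := by
  refine ((hasDerivAt_add_rpow (-b) h).neg.sub ((((hasDerivAt_id s).const_sub 1).const_mul b).mul
    (hasDerivAt_add_rpow (-b - 1) h))).congr_deriv ?_
  simp only [profileDeriv2, id]
  ring

theorem hasDerivAt_profile_time (b : ℝ) {T t s : ℝ} (h : 0 < T - t + s) :
    HasDerivAt (fun t => profile b (T - t) s) (b * (1 - s) * (T - t + s) ^ (-b - 1)) t := by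
  have h1 : HasDerivAt (fun t : ℝ => T - t + s) (-1) t :=
    ((hasDerivAt_id t).const_sub T).add_const s
  refine ((h1.rpow_const (p := -b) (Or.inl h.ne')).const_mul (1 - s)).congr_deriv ?_
  ring

/-- Writing `1 - s = (1 + τ) - (τ + s)` turns the squared profile into a combination of three powers
of `τ + s`. The nonvanishing conditions exclude logarithmic primitives. -/
theorem hasDerivAt_pressureProfile {b τ s : ℝ} (h : 0 < τ + s) (h1 : 1 - 2 * b ≠ 0)
    (h2 : 2 - 2 * b ≠ 0) (h3 : 3 - 2 * b ≠ 0) :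
    HasDerivAt (pressureProfile b τ) (profile b τ s ^ 2 / 2) s := by
  have d (c : ℝ) (hc : c ≠ 0) : HasDerivAt (fun s => (τ + s) ^ c / c) ((τ + s) ^ (c - 1)) s := by
    refine ((hasDerivAt_add_rpow c h).div_const c).congr_deriv ?_
    field_simp
  refine (((((d _ h1).const_mul ((1 + τ) ^ 2)).sub ((d _ h2).const_mul (2 * (1 + τ)))).add
    (d _ h3)).div_const 2).congr_deriv ?_
  have e0 : (τ + s) ^ (1 - 2 * b - 1) = ((τ + s) ^ (-b)) ^ 2 := by
    rw [← Real.rpow_natCast, ← Real.rpow_mul h.le]; congr 1; push_cast; ring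
  have e1 : (τ + s) ^ (2 - 2 * b - 1) = ((τ + s) ^ (-b)) ^ 2 * (τ + s) := by
    rw [← e0, ← Real.rpow_add_one h.ne']; congr 1; ring
  have e2 : (τ + s) ^ (3 - 2 * b - 1) = ((τ + s) ^ (-b)) ^ 2 * (τ + s) * (τ + s) := by
    rw [← e1, ← Real.rpow_add_one h.ne']; congr 1; ring
  rw [e0, e1, e2, profile]
  ring

theorem abs_profile_le (b : ℝ) {τ s : ℝ} (hτ : 0 < τ) (hs : 0 ≤ s) (hs1 : s ≤ 1) :
    |profile b τ s| ≤ (τ + s) ^ (-b) := by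
  have h := Real.rpow_nonneg (add_nonneg hτ.le hs) (-b)
  rw [profile, abs_of_nonneg (mul_nonneg (by linarith) h)]
  exact mul_le_of_le_one_left h (by linarith)

/-- A factor `s` compensates one negative power of `τ + s`; this keeps the derivatives of the
profile at the expected order. -/
theorem mul_rpow_sub_one_le (c : ℝ) {τ s : ℝ} (hτ : 0 < τ) (hs : 0 ≤ s) :
    s * (τ + s) ^ (c - 1) ≤ (τ + s) ^ c := by
  have h : 0 < τ + s := by linarith
  calc s * (τ + s) ^ (c - 1) ≤ (τ + s) * (τ + s) ^ (c - 1) := by gcongr; linarith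
    _ = (τ + s) ^ c := by rw [mul_comm, ← Real.rpow_add_one h.ne', sub_add_cancel]

/-- In the velocity gradient the weight `s = ρ` arises as `√ρ · √ρ`, one root from `|∇ρ| = 2√ρ` and
one from `|rot x| = √ρ`. -/
theorem mul_abs_profileDeriv_le {b τ s : ℝ} (hb : 0 ≤ b) (hτ : 0 < τ) (hs : 0 ≤ s)
    (hs1 : s ≤ 1) : s * |profileDeriv b τ s| ≤ (1 + b) * (τ + s) ^ (-b) := by
  have h : 0 ≤ τ + s := by linarith
  have h0 := Real.rpow_nonneg h (-b)
  have h1 := Real.rpow_nonneg h (-b - 1)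
  have h2 := mul_rpow_sub_one_le (-b) hτ hs
  have habs : |profileDeriv b τ s| ≤ (τ + s) ^ (-b) + b * (τ + s) ^ (-b - 1) := by
    have : 0 ≤ b * (1 - s) * (τ + s) ^ (-b - 1) :=
      mul_nonneg (mul_nonneg hb (by linarith)) h1
    have : 0 ≤ b * s * (τ + s) ^ (-b - 1) := by positivity
    rw [profileDeriv, abs_le]
    constructor <;> linarith
  calc s * |profileDeriv b τ s| ≤ s * ((τ + s) ^ (-b) + b * (τ + s) ^ (-b - 1)) := by gcongr
    _ = s * (τ + s) ^ (-b) + b * (s * (τ + s) ^ (-b - 1)) := by ring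
    _ ≤ 1 * (τ + s) ^ (-b) + b * (τ + s) ^ (-b) := by gcongr
    _ = _ := by ring

theorem abs_forceProfile_le {b τ s M : ℝ} (hb : 0 ≤ b) (hτ : 0 < τ) (hτM : τ ≤ M) (hs : 0 ≤ s)
    (hs1 : s ≤ 1) :
    |forceProfile b τ s| ≤ (17 * b + 4 * (b * (b + 1)) + 8 * (1 + M)) * (τ + s) ^ (-b - 1) := by
  have h : 0 < τ + s := by linarith
  set p1 := (τ + s) ^ (-b - 1) with hp1
  set p2 := (τ + s) ^ (-b - 1 - 1) with hp2
  have h1 : 0 ≤ p1 := Real.rpow_nonneg h.le _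
  have h2 : 0 ≤ p2 := Real.rpow_nonneg h.le _
  have h3 : s * p2 ≤ p1 := mul_rpow_sub_one_le _ hτ hs
  have h4 : (τ + s) ^ (-b) = (τ + s) * p1 := by
    rw [hp1, mul_comm, ← Real.rpow_add_one h.ne', sub_add_cancel]
  -- Everything is measured in units of `p1`. The coefficient `9 b` adds `8 b` from the first
  -- derivative to `b` from the time derivative; with the `8 b` of the first term it gives the `17
  -- b` of the bound.
  have e : forceProfile b τ s = 8 * b * (s * p1) + 4 * (b * (b + 1)) * ((1 - s) * (s * p2))
      - 8 * ((τ + s) * p1) - 9 * b * ((1 - s) * p1) := by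
    rw [forceProfile, profileDeriv2, profileDeriv, h4]
    ring
  have i1 : 0 ≤ s * p1 := by positivity
  have i1' : s * p1 ≤ p1 := mul_le_of_le_one_left h1 hs1
  have i2 : 0 ≤ (1 - s) * (s * p2) := mul_nonneg (by linarith) (by positivity)
  have i2' : (1 - s) * (s * p2) ≤ p1 :=
    (mul_le_of_le_one_left (by positivity) (by linarith)).trans h3
  have i3 : 0 ≤ (τ + s) * p1 := by positivity
  have i3' : (τ + s) * p1 ≤ (1 + M) * p1 :=
    mul_le_mul_of_nonneg_right (by linarith) h1
  have i4 : 0 ≤ (1 - s) * p1 := mul_nonneg (by linarith) h1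
  have i4' : (1 - s) * p1 ≤ p1 := mul_le_of_le_one_left h1 (by linarith)
  have hbb : 0 ≤ 4 * (b * (b + 1)) := by positivity
  have j1 := mul_le_mul_of_nonneg_left i1' (by positivity : 0 ≤ 8 * b)
  have j2 := mul_le_mul_of_nonneg_left i2' hbb
  have j4 := mul_le_mul_of_nonneg_left i4' (by positivity : 0 ≤ 9 * b)
  have k1 := mul_nonneg (by positivity : 0 ≤ 8 * b) i1
  have k2 := mul_nonneg hbb i2
  have k4 := mul_nonneg (by positivity : 0 ≤ 9 * b) i4
  have k5 : 0 ≤ 8 * b * p1 := by positivity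
  have k6 : 0 ≤ 4 * (b * (b + 1)) * p1 := by positivity
  have k7 : 0 ≤ 9 * b * p1 := by positivity
  rw [e, abs_le]
  constructor <;> linarith

theorem sqrt_mul_rpow_le (c : ℝ) {τ s : ℝ} (hτ : 0 < τ) (hs : 0 ≤ s) :
    (τ + s) ^ c * √s ≤ (τ + s) ^ (c + 1 / 2) := by
  have h : 0 < τ + s := by linarith
  rw [Real.rpow_add h, ← Real.sqrt_eq_rpow]
  gcongr
  linarith

/-! ### The solution -/

/-- The velocity: a swirl that concentrates at the axis as `t → T`. -/
noncomputable def velocity (b T t : ℝ) (x : E3) : E3 := profile b (T - t) (rho x) • rot x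

/-- The pressure that balances the centrifugal force of `velocity`. -/
noncomputable def pressure (b T t : ℝ) (x : E3) : ℝ := pressureProfile b (T - t) (rho x)

/-- The force that drives `velocity`. -/
noncomputable def force (b T t : ℝ) (x : E3) : E3 := forceProfile b (T - t) (rho x) • rot x

theorem contDiff_rho : ContDiff ℝ ∞ rho := by unfold rho; fun_prop

theorem contDiffOn_weight (T c : ℝ) :
    ContDiffOn ℝ ∞ (fun z : ℝ × E3 => (T - z.1 + rho z.2) ^ c) (Iio T ×ˢ univ) := by
  refine ContDiffOn.rpow_const_of_ne ?_ fun z hz => ?_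
  · exact ((contDiff_const.sub contDiff_fst).add (contDiff_rho.comp contDiff_snd)).contDiffOn
  · have h1 : z.1 < T := hz.1
    have := rho_nonneg z.2
    linarith

theorem contDiffOn_rho_snd (s : Set (ℝ × E3)) :
    ContDiffOn ℝ ∞ (fun z : ℝ × E3 => rho z.2) s :=
  (contDiff_rho.comp contDiff_snd).contDiffOn

theorem contDiffOn_rot_snd (s : Set (ℝ × E3)) :
    ContDiffOn ℝ ∞ (fun z : ℝ × E3 => rot z.2) s :=
  (rot.contDiff.comp contDiff_snd).contDiffOn

theorem contDiffOn_profile (b T : ℝ) :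
    ContDiffOn ℝ ∞ (fun z : ℝ × E3 => profile b (T - z.1) (rho z.2)) (Iio T ×ˢ univ) :=
  (contDiffOn_const.sub (contDiffOn_rho_snd _)).mul (contDiffOn_weight T _)

theorem contDiffOn_profileDeriv (b T : ℝ) :
    ContDiffOn ℝ ∞ (fun z : ℝ × E3 => profileDeriv b (T - z.1) (rho z.2)) (Iio T ×ˢ univ) :=
  (contDiffOn_weight T _).neg.sub
    ((contDiffOn_const.mul (contDiffOn_const.sub (contDiffOn_rho_snd _))).mul
      (contDiffOn_weight T _))

theorem contDiffOn_velocity (b T : ℝ) :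
    ContDiffOn ℝ ∞ (Function.uncurry (velocity b T)) (Iio T ×ˢ univ) :=
  (contDiffOn_profile b T).smul (contDiffOn_rot_snd _)

theorem contDiffOn_pressure (b T : ℝ) :
    ContDiffOn ℝ ∞ (Function.uncurry (pressure b T)) (Iio T ×ˢ univ) := by
  have hτ : ContDiffOn ℝ ∞ (fun z : ℝ × E3 => 1 + (T - z.1)) (Iio T ×ˢ univ) := by fun_prop
  exact ((((hτ.pow 2).mul ((contDiffOn_weight T _).div_const _)).sub
    ((contDiffOn_const.mul hτ).mul ((contDiffOn_weight T _).div_const _))).add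
    ((contDiffOn_weight T _).div_const _)).div_const _

theorem contDiffOn_force (b T : ℝ) :
    ContDiffOn ℝ ∞ (Function.uncurry (force b T)) (Iio T ×ˢ univ) := by
  have hρ := contDiffOn_rho_snd (Iio T ×ˢ univ)
  have h1 : ContDiffOn ℝ ∞ (fun z : ℝ × E3 => 1 - rho z.2) (Iio T ×ˢ univ) :=
    contDiffOn_const.sub hρ
  have h2 : ContDiffOn ℝ ∞ (fun z : ℝ × E3 => profileDeriv2 b (T - z.1) (rho z.2))
      (Iio T ×ˢ univ) :=
    (contDiffOn_const.mul (contDiffOn_weight T _)).add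
      ((contDiffOn_const.mul h1).mul (contDiffOn_weight T _))
  exact ((((contDiffOn_const.mul hρ).mul h2).add
    (contDiffOn_const.mul (contDiffOn_profileDeriv b T))).sub
    ((contDiffOn_const.mul h1).mul (contDiffOn_weight T _))).smul (contDiffOn_rot_snd _)

theorem Ico_prod_D_subset (T : ℝ) : Ico 0 T ×ˢ D ⊆ Iio T ×ˢ (univ : Set E3) :=
  prod_mono (fun _ h => h.2) (subset_univ _)

theorem hasFDerivAt_velocity (b : ℝ) {T t : ℝ} (ht : t < T) (x : E3) :
    HasFDerivAt (velocity b T t)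
      (swirlDeriv (profile b (T - t) (rho x)) (profileDeriv b (T - t) (rho x)) x) x :=
  hasFDerivAt_swirl (hasDerivAt_profile b (by linarith [rho_nonneg x]))

theorem isClassicalSolution_velocity {b T : ℝ} (h1 : 1 - 2 * b ≠ 0) (h2 : 2 - 2 * b ≠ 0)
    (h3 : 3 - 2 * b ≠ 0) :
    IsClassicalSolution T (force b T) (velocity b T) (pressure b T) where
  velocity_regular :=
    contDiffOn_infty.1 ((contDiffOn_velocity b T).mono (Ico_prod_D_subset T)) 2
  pressure_regular :=
    contDiffOn_infty.1 ((contDiffOn_pressure b T).mono (Ico_prod_D_subset T)) 1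
  momentum t ht x _ := by
    have hpos : ∀ s, 0 ≤ s → 0 < T - t + s := fun s hs => by linarith [ht.2]
    have hx := hpos _ (rho_nonneg x)
    have hlap : Δ (velocity b T t) x = _ :=
      laplacian_swirl (fun s hs => hasDerivAt_profile b (hpos s hs)) (hasDerivAt_profileDeriv b hx)
    have hconv : fderiv ℝ (velocity b T t) x (velocity b T t x) + ∇ (pressure b T t) x = 0 :=
      convection_swirl (hasDerivAt_profile b hx) (hasDerivAt_pressureProfile hx h1 h2 h3)
    have htime : deriv (fun s => velocity b T s x) t = _ :=
      ((hasDerivAt_profile_time b hx).smul_const (rot x)).deriv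
    rw [sub_sub _ _ (∇ (pressure b T t) x), hconv, hlap, htime, sub_zero, ← sub_smul]
    rfl
  incompressible t ht x _ :=
    divergence_swirl (hasDerivAt_profile b (by linarith [ht.2, rho_nonneg x]))
  no_slip t _ x hx := by
    have : rho x = 1 := hx.2
    simp [velocity, profile, this]
  total_slip t ht x hx := by
    have hd : fderivWithin ℝ (velocity b T t) D x (stdVec 2) = 0 := by
      rw [(hasFDerivAt_velocity b ht.2 x).hasFDerivWithinAt.fderivWithin (uniqueDiffOn_D x hx.1),
        swirlDeriv_apply, rot_stdVec, rhoDeriv_apply]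
      simp [stdVec_apply]
    simp [hd, velocity, rot_apply_two]

theorem norm_velocity_le (b : ℝ) {T t : ℝ} (ht : t < T) {x : E3} (hx : x ∈ D) :
    ‖velocity b T t x‖ ≤ (T - t + rho x) ^ (-b + 1 / 2) := by
  have hτ : 0 < T - t := sub_pos.2 ht
  rw [velocity, norm_smul, norm_rot, Real.norm_eq_abs]
  exact (mul_le_mul_of_nonneg_right (abs_profile_le b hτ (rho_nonneg x) (rho_le_one hx))
    (Real.sqrt_nonneg _)).trans (sqrt_mul_rpow_le _ hτ (rho_nonneg x))

theorem norm_fderiv_velocity_le {b T t : ℝ} (hb : 0 ≤ b) (ht : t < T) {x : E3} (hx : x ∈ D) :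
    ‖fderiv ℝ (velocity b T t) x‖ ≤ (3 + 2 * b) * (T - t + rho x) ^ (-b) := by
  have hτ : 0 < T - t := sub_pos.2 ht
  have hρ := rho_nonneg x
  have hy := Real.rpow_nonneg (add_nonneg hτ.le hρ) (-b)
  rw [(hasFDerivAt_velocity b ht x).fderiv]
  refine ContinuousLinearMap.opNorm_le_bound _ (by positivity) fun h => ?_
  have i0 := abs_profile_le b hτ hρ (rho_le_one hx)
  have i1 := mul_abs_profileDeriv_le hb hτ hρ (rho_le_one hx)
  set p := profile b (T - t) (rho x)
  set p' := profileDeriv b (T - t) (rho x)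
  calc ‖swirlDeriv p p' x h‖
      ≤ |p| * √(rho h) + |p'| * |rhoDeriv x h| * √(rho x) := by
        rw [swirlDeriv_apply]
        refine (norm_add_le _ _).trans_eq ?_
        simp only [norm_smul, norm_rot, Real.norm_eq_abs, abs_mul]
    _ ≤ |p| * ‖h‖ + |p'| * (2 * √(rho x) * ‖h‖) * √(rho x) := by
        gcongr
        · exact sqrt_rho_le_norm h
        · exact abs_rhoDeriv_le x h
    _ = (|p| + 2 * (√(rho x) * √(rho x) * |p'|)) * ‖h‖ := by ring
    _ = (|p| + 2 * (rho x * |p'|)) * ‖h‖ := by rw [Real.mul_self_sqrt hρ]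
    _ ≤ (3 + 2 * b) * (T - t + rho x) ^ (-b) * ‖h‖ := by
        gcongr
        linarith

theorem norm_force_le {b T t : ℝ} (hb : 0 ≤ b) (ht : t ∈ Ioo 0 T) {x : E3} (hx : x ∈ D) :
    ‖force b T t x‖ ≤ (17 * b + 4 * (b * (b + 1)) + 8 * (1 + T))
      * (T - t + rho x) ^ (-b - 1 + 1 / 2) := by
  have hτ : 0 < T - t := sub_pos.2 ht.2
  have hT : 0 < T := ht.1.trans ht.2
  rw [force, norm_smul, norm_rot, Real.norm_eq_abs]
  refine (mul_le_mul_of_nonneg_right (abs_forceProfile_le hb hτ (M := T) (by linarith [ht.1])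
    (rho_nonneg x) (rho_le_one hx)) (Real.sqrt_nonneg _)).trans ?_
  rw [mul_assoc]
  gcongr
  exact sqrt_mul_rpow_le _ hτ (rho_nonneg x)

theorem continuousOn_fderiv_velocity (b T : ℝ) :
    ContinuousOn (Function.uncurry fun t x => fderiv ℝ (velocity b T t) x) (Ioo 0 T ×ˢ D) := by
  have hsub : Ioo 0 T ×ˢ D ⊆ Iio T ×ˢ (univ : Set E3) :=
    prod_mono (fun _ h => h.2) (subset_univ _)
  have hρ : ContDiff ℝ 1 rhoDeriv := by unfold rhoDeriv; fun_prop
  have h1 := (hρ.smulRight rot.contDiff).continuous.comp (continuous_snd (X := ℝ))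
  refine ContinuousOn.congr (f := fun z : ℝ × E3 => swirlDeriv (profile b (T - z.1) (rho z.2))
    (profileDeriv b (T - z.1) (rho z.2)) z.2) ?_ fun z hz =>
    (hasFDerivAt_velocity b hz.1.2 z.2).fderiv
  exact (((contDiffOn_profile b T).continuousOn.mono hsub).smul continuousOn_const).add
    (((contDiffOn_profileDeriv b T).continuousOn.mono hsub).smul h1.continuousOn)

/-- The maximum of the velocity, which is attained at distance `√(T - t)` from the axis up to a
constant, blows up. -/
theorem tendsto_eLpNorm_velocity {b : ℝ} (hb : 1 / 2 < b) (T : ℝ) :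
    Tendsto (fun t => eLpNorm (velocity b T t) ⊤ (volume.restrict D)) (𝓝[<] T) (𝓝 ⊤) := by
  have hlow : ∀ᶠ t in 𝓝[<] T, ENNReal.ofReal (2⁻¹ * 2 ^ (-b) * (T - t) ^ (1 / 2 - b))
      ≤ eLpNorm (velocity b T t) ⊤ (volume.restrict D) := by
    -- For `τ < 1/2` the point with `ρ = τ` is interior and `1 - τ ≥ 1/2`, whence the constant
    -- `2⁻¹`; the constant `2 ^ (-b)` comes from `τ + ρ = 2 τ`.
    have h1 : ∀ᶠ t in 𝓝[<] T, T - 1 / 2 < t :=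
      (eventually_gt_nhds (by linarith)).filter_mono nhdsWithin_le_nhds
    filter_upwards [self_mem_nhdsWithin, h1] with t ht ht1
    have ht : t < T := ht
    have hτ : 0 < T - t := sub_pos.2 ht
    set x : E3 := !₂[√(T - t), 0, 1 / 2] with hxdef
    have hρ : rho x = T - t := by simp [rho, hxdef, Real.sq_sqrt hτ.le]
    have hx : x ∈ interior D := strict_D_subset_interior
      ⟨show rho x < 1 by rw [hρ]; linarith, by simp [hxdef], by simp [hxdef]; norm_num⟩
    have hcont : Continuous (velocity b T t) := continuous_iff_continuousAt.2 fun y =>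
      (hasFDerivAt_velocity b ht y).continuousAt
    refine le_trans ?_ (enorm_le_eLpNorm_top hcont hx)
    rw [← ofReal_norm]
    refine ENNReal.ofReal_le_ofReal ?_
    have hp : profile b (T - t) (T - t) = (1 - (T - t)) * (2 ^ (-b) * (T - t) ^ (-b)) := by
      rw [profile, ← two_mul, Real.mul_rpow zero_le_two hτ.le]
    have hr : (T - t) ^ (1 / 2 - b) = (T - t) ^ (-b) * √(T - t) := by
      rw [Real.sqrt_eq_rpow, ← Real.rpow_add hτ]; congr 1; ring
    have hnn : 0 ≤ (2 : ℝ) ^ (-b) * (T - t) ^ (-b) := by positivity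
    rw [velocity, norm_smul, norm_rot, hρ, hp, hr, Real.norm_eq_abs,
      abs_of_nonneg (mul_nonneg (by linarith) hnn)]
    calc 2⁻¹ * 2 ^ (-b) * ((T - t) ^ (-b) * √(T - t))
        = 2⁻¹ * (2 ^ (-b) * (T - t) ^ (-b)) * √(T - t) := by ring
      _ ≤ (1 - (T - t)) * (2 ^ (-b) * (T - t) ^ (-b)) * √(T - t) := by
          gcongr
          linarith
  refine tendsto_of_tendsto_of_tendsto_of_le_of_le' ?_ tendsto_const_nhds hlow
    (Eventually.of_forall fun _ => le_top)
  have hsub : Tendsto (fun t => T - t) (𝓝[<] T) (𝓝[>] 0) := by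
    refine tendsto_nhdsWithin_iff.2 ⟨?_, ?_⟩
    · have : Continuous fun t : ℝ => T - t := by fun_prop
      simpa using (this.tendsto T).mono_left nhdsWithin_le_nhds
    · filter_upwards [self_mem_nhdsWithin] with t ht using sub_pos.2 (mem_Iio.1 ht)
  exact ENNReal.tendsto_ofReal_atTop.comp (((tendsto_rpow_neg_nhdsGT_zero
    (by linarith : 1 / 2 - b < 0)).comp hsub).const_mul_atTop (by positivity))

/-- The blow-up example: for `η` positive and small with respect to the exponents, the velocity is
of order `(T - t + ρ)^(-η)`. -/
theorem existsBlowup_of_small {T η : ℝ} {q p q' p' : ℝ≥0∞} (hT : 0 < T) (hη : 0 < η)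
    (hη2 : η < 1 / 2) (hq0 : q ≠ 0) (hq : q ≠ ⊤) (hp0 : p ≠ 0) (hp : p ≠ ⊤) (hq'0 : q' ≠ 0)
    (hp'0 : p' ≠ 0) (hp' : p' ≠ ⊤) (hηp' : η * p'.toReal < 1)
    {a c : ℝ} (ha : 0 ≤ a) (hc : 0 ≤ c) (hac : a + c = 1 + η) (haq : a * q.toReal < 1)
    (hcp : c * p.toReal < 1) : ExistsBlowup T q p q' p' := by
  set b : ℝ := 1 / 2 + η with hb
  have hb0 : 0 ≤ b := by linarith
  have hsub : Ioo 0 T ×ˢ D ⊆ Iio T ×ˢ (univ : Set E3) :=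
    prod_mono (fun _ h => h.2) (subset_univ _)
  have hcv := (contDiffOn_velocity b T).continuousOn.mono hsub
  have hsol : IsClassicalSolution T (force b T) (velocity b T) (pressure b T) :=
    -- The three exponents are `-2η`, `1 - 2η` and `2 - 2η`, nonzero since `0 < η < 1/2`.
    isClassicalSolution_velocity (by linarith) (by linarith) (by linarith)
  have hv {r m : ℝ≥0∞} (hr : r ≠ 0) (hm0 : m ≠ 0) (hm : m ≠ ⊤) (hηm : η * m.toReal < 1) :
      MemLqLp T r m (velocity b T) := by
    refine memLqLp_of_le (C := 1) hT hcv le_rfl hη.le hr (Or.inl rfl) hm0 hm hηm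
      fun t ht x hx => ?_
    rw [one_mul]
    convert norm_velocity_le b ht.2 hx using 2
    rw [hb]; ring
  refine ⟨force b T, velocity b T, pressure b T, ?_,
    (contDiffOn_force b T).mono (Ico_prod_D_subset T), hsol,
    (contDiffOn_velocity b T).mono (Ico_prod_D_subset T),
    (contDiffOn_pressure b T).mono (Ico_prod_D_subset T),
    fun w Q hw h0 => hsol.unique hw h0,
    hv ENNReal.top_ne_zero two_ne_zero ENNReal.ofNat_ne_top (by simp; linarith),
    hv two_ne_zero two_ne_zero ENNReal.ofNat_ne_top (by simp; linarith), ?_,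
    hv hq'0 hp'0 hp' hηp', tendsto_eLpNorm_velocity (by linarith) T, ?_⟩
  · refine memLqLp_of_le (C := 17 * b + 4 * (b * (b + 1)) + 8 * (1 + T)) hT
      ((contDiffOn_force b T).continuousOn.mono hsub) ha hc hq0
      (Or.inr ⟨hq, haq⟩) hp0 hp hcp fun t ht x hx => ?_
    convert norm_force_le hb0 ht hx using 3
    rw [hb]; linarith
  -- The exponent `b` of the gradient is shared equally between time and space; both conditions
  -- become `b < 1`, that is `η < 1/2`.
  · refine memLqLp_of_le (C := 3 + 2 * b) (a := b / 2) (c := b / 2) hT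
      (continuousOn_fderiv_velocity b T)
      (by linarith) (by linarith) two_ne_zero
      (Or.inr ⟨ENNReal.ofNat_ne_top, by simp; linarith⟩) two_ne_zero ENNReal.ofNat_ne_top
      (by simp; linarith) fun t ht x hx => ?_
    rw [add_halves]
    exact norm_fderiv_velocity_le hb0 ht.2 hx
  · intro S hS
    obtain ⟨C, hC⟩ := exists_bound_of_continuousOn
      ((contDiffOn_velocity b T).continuousOn.mono (Ico_prod_D_subset T)) le_rfl hS.2
    exact ⟨C, fun t ht x hx => hC t ht x hx⟩

/-- Admissible exponents leave room for a small `η`. -/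
theorem existsBlowup {T : ℝ} {q p q' p' : ℝ≥0∞} (hT : 0 < T) (hq' : 1 ≤ q') (hp' : 1 ≤ p')
    (hp'_fin : p' < ⊤) (hq : 1 ≤ q) (hp : 1 ≤ p) (hpq : p < 1 + 1 / q) :
    ExistsBlowup T q p q' p' := by
  have hqt : q ≠ ⊤ := by
    rintro rfl
    simp only [one_div, ENNReal.inv_top, add_zero] at hpq
    exact absurd hpq hp.not_gt
  have hq0 : q ≠ 0 := (zero_lt_one.trans_le hq).ne'
  have hp0 : p ≠ 0 := (zero_lt_one.trans_le hp).ne'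
  have hp'0 : p' ≠ 0 := (zero_lt_one.trans_le hp').ne'
  have hrt : 1 + 1 / q ≠ ⊤ := by simp [hq0]
  have hpt : p ≠ ⊤ := (hpq.trans_le le_top).ne
  set y := q.toReal with hy
  set z := p.toReal with hz
  set m := p'.toReal with hm
  have hy1 : 1 ≤ y := by simpa using ENNReal.toReal_mono hqt hq
  have hz1 : 1 ≤ z := by simpa using ENNReal.toReal_mono hpt hp
  have hm1 : 1 ≤ m := by simpa using ENNReal.toReal_mono hp'_fin.ne hp'
  have hzy : z < 1 + 1 / y := by
    have h := (ENNReal.toReal_lt_toReal hpt hrt).2 hpq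
    rwa [ENNReal.toReal_add ENNReal.one_ne_top (by simp [hq0]), ENNReal.toReal_div,
      ENNReal.toReal_one] at h
  have hy0 : 0 < y := by linarith
  have hz0 : 0 < z := by linarith
  have hm0 : 0 < m := by linarith
  -- From `z y < y + 1 ≤ y + z`. The number `κ` is the room left for `η`.
  have hκ : 0 < 1 / y + 1 / z - 1 := by
    have h1 : z * y < y + 1 := by
      calc z * y < (1 + 1 / y) * y := by gcongr
        _ = y + 1 := by field_simp
    have h2 : 1 / y + 1 / z - 1 = (z + y - z * y) / (y * z) := by field_simp
    rw [h2]
    apply div_pos <;> nlinarith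
  set κ := 1 / y + 1 / z - 1 with hκdef
  have hyi : 1 / y ≤ 1 := by rw [div_le_one hy0]; exact hy1
  have hzi : 1 / z ≤ 1 := by rw [div_le_one hz0]; exact hz1
  have hmi : 0 < 1 / m := by positivity
  have hyi0 : 0 < 1 / y := by positivity
  have hzi0 : 0 < 1 / z := by positivity
  obtain ⟨η, hη0, hη⟩ := exists_between (lt_min (lt_min one_half_pos hmi) hκ)
  simp only [lt_min_iff] at hη
  obtain ⟨⟨hη2, hηm⟩, hηκ⟩ := hη
  -- Lowering `1 / y` and `1 / z` by `(κ - η) / 2` each makes both integrability conditions strict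
  -- and the sum exactly `1 + η`. Nonnegativity holds because `κ` is at most `1 / y` and `1 / z`.
  refine existsBlowup_of_small hT hη0 hη2 hq0 hqt hp0 hpt (zero_lt_one.trans_le hq').ne' hp'0
    hp'_fin.ne ((lt_div_iff₀ hm0).1 hηm) (a := 1 / y - (κ - η) / 2) (c := 1 / z - (κ - η) / 2)
    (by linarith) (by linarith) (by linarith) ((lt_div_iff₀ hy0).1 (by linarith))
    ((lt_div_iff₀ hz0).1 (by linarith))

end NSCylinder

theorem corollary2 (T : ℝ) (hT : 0 < T) (q' p' : ℝ≥0∞) (hq' : 1 ≤ q') (hp' : 1 ≤ p')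
    (hp'_fin : p' < ⊤) :
    (∀ q p : ℝ≥0∞, 1 ≤ q → 1 ≤ p → p < 1 + 1 / q → NSCylinder.ExistsBlowup T q p q' p') ∧
    (∀ p : ℝ≥0∞, 1 ≤ p → p < 2 → NSCylinder.ExistsBlowup T 1 p q' p') ∧
    (∀ q : ℝ≥0∞, 1 ≤ q → q < ⊤ → NSCylinder.ExistsBlowup T q 1 q' p') := by
  refine ⟨fun q p hq hp hpq => NSCylinder.existsBlowup hT hq' hp' hp'_fin hq hp hpq,
    fun p hp hp2 => NSCylinder.existsBlowup hT hq' hp' hp'_fin le_rfl hp ?_,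
    fun q hq hqt => NSCylinder.existsBlowup hT hq' hp' hp'_fin hq le_rfl ?_⟩
  · rwa [div_one, one_add_one_eq_two]
  · exact ENNReal.lt_add_right ENNReal.one_ne_top (by simp [hqt.ne])
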